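/- **Setting.** For $t\in\mathbb R$ put $\|t\|_{\tilde{\mathbb T}}=|\operatorname{Arg}e^{it}|$. Let $\Delta>0$, $2\le\ell\le s$ (integers), $\ell-1\le\tau\le\pi/\Delta$, $\rho\ge 0$. A set $\boldsymbol t$ of $s$ distinct nodes in $(-\frac\pi2,\frac\pi2]$ forms a *$(\Delta,\rho,s,\ell,\tau)$-clustered configuration* if every $t\in\boldsymbol t$ belongs to some $\boldsymbol t^{(t)}\subseteq\boldsymbol t$ with at most $\ell$ elements such that $\Delta\le\|y-t\|_{\tilde{\mathbb T}}\le\tau\Delta$ for all $y\in\boldsymbol t^{(t)}\setminus\{t\}$ and $\|y-t\|_{\tilde{\mathbb T}}\ge\rho$ for all $y\in\boldsymbol t\setminus\boldsymbol t^{(t)}$. Let $\mathcal T_\Delta=\{k\Delta: k\in\mathbb Z,\ |k|\le\lfloor\pi/(2\Delta)\rfloor\}$, and let $\mathcal R=\mathcal R(\Delta,\rho,s,\ell,\tau)$ be the set of distributions $\mu=\sum_{j=1}^s a_j\delta_{t_j}+b_j\delta'_{t_j}$ with $a_j,b_j\in\mathbb C$ (possibly zero), $t_j\in\mathcal T_\Delta$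 and $\{t_1,\dots,t_s\}$ a $(\Delta,\rho,s,\ell,\tau)$-clustered configuration (so $\mathcal R$ is empty if the parameters violate the constraints above). Let $\hat{\mathcal R}=\{\mu\in\mathcal R:\operatorname{supp}\mu\subset\frac1{s^2}(-\frac\pi2,\frac\pi2]\}$. Put $\|\mu\|_2=(\sum_j|a_j|^2+|b_j|^2)^{1/2}$ and $\hat\mu(k)=\langle\mu,e^{-ikx}\rangle$. For an integer $N\ge1$ and $\varepsilon>0$ let $B^N_\varepsilon(\mu)=\{y\in\mathbb C^{2N+1}:(\frac1{2N}\sum_{k=0}^{2N}|y_k-\hat\mu(k)|^2)^{1/2}<\varepsilon\}$. For a set $\mathcal S$ of such distributions, the min-max error is $$\mathcal E(\mathcal S,N,\varepsilon)=\inf_{\varphi}\ \sup_{\mu\in\mathcal S}\ \sup_{y\in B^N_\varepsilon(\mu)}\|\varphi(y)-\mu\|_2\in[0,\infty],$$ where $\varphi$ runs over all maps $\bigcup_{\mu\in\mathcal S}B^N_\varepsilon(\mu)\to\mathcal S$ (and the suprema are $0$ if $\mathcal S=\emptyset$). Put $SRF=\frac1{N\Delta}$. **Theorem.** Let $2\le\ell\le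 s$ and $\varepsilon>0$. 1. (Upper bound.) There is a constant $C_{s,\ell}>0$ depending only on $s$ and $\ell$ such that the following holds. For all real $\rho\ge0$ (with $\rho>0$ if $\ell<s$), $\tau\ge\ell-1$ and $M\ge\pi$ there exist $\beta\ge M$ and $\Delta_0>0$ such that for all $0<\Delta\le\Delta_0$ and all $N\in\mathbb N$ with $SRF=\beta$, $$\mathcal E(\hat{\mathcal R}(\Delta,\rho,s,\ell,\tau),N,\varepsilon)\le C_{s,\ell}\,SRF^{4\ell-1}\,\varepsilon.$$ 2. (Lower bound.) For every $\tau\ge\ell-1$ there is a constant $C_{\ell,\tau}>0$ depending only on $\ell$ and $\tau$ such that for all $\rho\ge0$, $0<\Delta\le\pi/\tau$ and integers $N\ge1$ with $N\Delta\le\frac12$ and $$\Big(\Big\lceil\frac s\ell\Big\rceil-1\Big)(\rho+\ell\Delta)+2(\ell+1)\Delta\le\pi,$$ (so that $\lceil s/\ell\rceil$ clusters fit into $(-\frac\pi2,\frac\pi2]$), $$\mathcal E(\mathcal R(\Delta,\rho,s,\ell,\tau),N,\varepsilon)\ge C_{\ell,\tau}\,SRF^{4\ell-1}\,\varepsilon.$$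 -/

import Mathlib

open Real
open scoped ENNReal

noncomputable section

/-- The wraparound distance of `t` to `0`, i.e. `|Arg (exp (i t))|`. -/
def wrapDist (t : ℝ) : ℝ :=
  |Complex.arg (Complex.exp (t * Complex.I))|

/-- The (finite) node set `x` forms a `(Δ, ρ, s, ℓ, τ)`-clustered configuration. The set `c` below is
the cluster of the node `u` (it contains `u` and has at most `ℓ` elements). -/
structure IsClustered (Δ ρ : ℝ) (s ℓ : ℕ) (τ : ℝ) (x : Finset ℝ) : Prop where
  step_pos : 0 < Δ
  two_le : 2 ≤ ℓ
  le_card : ℓ ≤ s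
  le_tau : (ℓ : ℝ) - 1 ≤ τ
  tau_le : τ ≤ π / Δ
  rho_nonneg : 0 ≤ ρ
  card_eq : x.card = s
  mem_Ioc : ∀ u ∈ x, u ∈ Set.Ioc (-(π / 2)) (π / 2)
  cluster : ∀ u ∈ x, ∃ c ⊆ x, u ∈ c ∧ c.card ≤ ℓ ∧
    (∀ y ∈ c, y ≠ u → Δ ≤ wrapDist (y - u) ∧ wrapDist (y - u) ≤ τ * Δ) ∧
    (∀ y ∈ x, y ∉ c → ρ ≤ wrapDist (y - u))

/-- The grid `{k Δ : k = -M, …, M}` with `M = ⌊π / (2 Δ)⌋`. -/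
def grid (Δ : ℝ) : Set ℝ :=
  {x | ∃ k : ℤ, -⌊π / (2 * Δ)⌋ ≤ k ∧ k ≤ ⌊π / (2 * Δ)⌋ ∧ x = k * Δ}

/-- A point distribution of order one, `μ = ∑ a_t δ_t + b_t δ'_t` (a finite sum over real points
`t`), recorded by its coefficients `t ↦ (a_t, b_t)`. The distributions `δ_t`, `δ'_t` are linearly
independent, so the coefficients and the distribution determine each other, and the support of the
distribution is the set of `t` with `(a_t, b_t) ≠ (0, 0)`, which is `μ.support`. -/
abbrev SpikeDistribution : Type := ℝ →₀ ℂ × ℂ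

namespace SpikeDistribution

/-- The value `⟨μ, f⟩` of the distribution on a smooth function `f`: `⟨δ_t, f⟩ = f t` and
`⟨δ'_t, f⟩ = - f' t`. -/
def pairing (μ : SpikeDistribution) (f : ℝ → ℂ) : ℂ :=
  ∑ t ∈ μ.support, ((μ t).1 * f t - (μ t).2 * deriv f t)

/-- The Fourier coefficient `⟨μ, e^{-ikx}⟩`. -/
def fourier (μ : SpikeDistribution) (k : ℕ) : ℂ :=
  μ.pairing fun x => Complex.exp (-(Complex.I * (k : ℂ) * (x : ℂ)))

/-- The discrete `ℓ²` norm of the coefficients. -/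
def l2norm (μ : SpikeDistribution) : ℝ :=
  √(∑ t ∈ μ.support, (‖(μ t).1‖ ^ 2 + ‖(μ t).2‖ ^ 2))

end SpikeDistribution

/-- The set of `μ = ∑ a_j δ_{t_j} + b_j δ'_{t_j}` with arbitrary complex coefficients (zero is
allowed), where the nodes `t_1, …, t_s` lie on the grid of step `Δ` and form a
`(Δ, ρ, s, ℓ, τ)`-clustered configuration. -/
def clusteredSpikes (Δ ρ : ℝ) (s ℓ : ℕ) (τ : ℝ) : Set SpikeDistribution :=
  {μ | ∃ t : Finset ℝ, (∀ u ∈ t, u ∈ grid Δ) ∧ IsClustered Δ ρ s ℓ τ t ∧ μ.support ⊆ t}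

/-- The elements of `clusteredSpikes` whose support lies in `(1/s²) (-π/2, π/2]`. -/
def localizedSpikes (Δ ρ : ℝ) (s ℓ : ℕ) (τ : ℝ) : Set SpikeDistribution :=
  {μ ∈ clusteredSpikes Δ ρ s ℓ τ |
    ∀ u ∈ μ.support, u ∈ Set.Ioc (-(π / 2) / (s : ℝ) ^ 2) ((π / 2) / (s : ℝ) ^ 2)}

/-- The set of noisy measurements of `μ`: all `y ∈ ℂ^{2N+1}` with
`((1 / 2N) ∑_{k=0}^{2N} |y_k - μ̂(k)|²)^{1/2} < ε`. -/
def dataBall (N : ℕ) (ε : ℝ) (μ : SpikeDistribution) : Set (Fin (2 * N + 1) → ℂ) :=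
  {y | √(1 / (2 * (N : ℝ)) * ∑ k : Fin (2 * N + 1), ‖y k - μ.fourier k‖ ^ 2) < ε}

/-- The reconstruction maps for the signal class `R`: every `y` that is a noisy measurement of some
element of `R` is sent to an element of `R` (the values at other `y` play no role). -/
def reconstructions (R : Set SpikeDistribution) (N : ℕ) (ε : ℝ) :
    Set ((Fin (2 * N + 1) → ℂ) → SpikeDistribution) :=
  {φ | ∀ μ ∈ R, ∀ y ∈ dataBall N ε μ, φ y ∈ R}

/-- The `ℓ²` min-max error, as an element of `[0, ∞]`. -/
def minmaxError (R : Set SpikeDistribution) (N : ℕ) (ε : ℝ) : ℝ≥0∞ :=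
  ⨅ φ ∈ reconstructions R N ε, ⨆ μ ∈ R, ⨆ y ∈ dataBall N ε μ,
    ENNReal.ofReal (φ y - μ).l2norm

/-- The super-resolution factor. -/
def SRF (N : ℕ) (Δ : ℝ) : ℝ := 1 / (N * Δ)

end

/-! Upper bound: return any signal of the class that fits the data. Two fitting signals differ by a
distribution with at most 2s grid nodes whose Fourier data have ℓ² norm at most 2ε√(2N). Pairing
these data with the coefficients of a polynomial P of degree at most 2N evaluates P and P' at the
points e^{-it}. If P has double zeros at all nodes but one, a single amplitude is isolated, and
Cauchy–Schwarz bounds it through the coefficient norm of P. `exists_dual_polynomials` builds P from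
normalised binomials X^q - w^q with q at most Q, of order N: the power turns a gap Δ into one of
order NΔ = 1/SRF. Each signal has at most ℓ nodes near a given one, so at most 2ℓ-1 other nodes are
close. Each costs SRF twice, and correcting the derivative costs one more: 4ℓ-1 in all. Far nodes
cost constants, and an averaging factor of norm Q^{-1/2} absorbs √N.

Lower bound: on 2ℓ consecutive grid points some nonzero combination of values and derivatives kills
all polynomials of degree below 4ℓ-1, so its k-th Fourier coefficient is O((kΔ)^{4ℓ-1}). Its two
halves extend to clustered configurations, which gives two signals with common admissible data at
distance of order SRF^{4ℓ-1} ε; no map can be close to both. -/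

/-- The point `e^{-it}` of the unit circle. -/
noncomputable def unitNode (t : ℝ) : ℂ := Complex.exp (-(Complex.I * (t : ℂ)))

theorem norm_unitNode (t : ℝ) : ‖unitNode t‖ = 1 := by
  rw [unitNode, Complex.norm_exp]; simp

/-! ### Fourier coefficients and the coefficient norm. -/

namespace SpikeDistribution

/-- The sign in ⟨δ', f⟩ = -f' cancels the one from differentiating e^{-ikx}, whence the factor +ik.
-/
theorem fourier_eq_sum (μ : SpikeDistribution) (k : ℕ) :
    μ.fourier k = μ.sum fun t p => (p.1 + p.2 * (Complex.I * k)) * unitNode t ^ k := by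
  unfold fourier pairing Finsupp.sum
  refine Finset.sum_congr rfl fun t _ => ?_
  have hd : HasDerivAt (fun x : ℝ => Complex.exp (-(Complex.I * (k : ℂ) * (x : ℂ))))
      (Complex.exp (-(Complex.I * (k : ℂ) * (t : ℂ))) * (-(Complex.I * (k : ℂ) * 1))) t := by
    refine HasDerivAt.cexp (HasDerivAt.neg (HasDerivAt.const_mul _ ?_))
    exact Complex.ofRealCLM.hasDerivAt
  rw [hd.deriv]
  have : unitNode t ^ k = Complex.exp (-(Complex.I * (k : ℂ) * (t : ℂ))) := by
    rw [unitNode, ← Complex.exp_nat_mul]; ring_nf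
  simp only [this]; ring

theorem fourier_add (μ ν : SpikeDistribution) (k : ℕ) :
    (μ + ν).fourier k = μ.fourier k + ν.fourier k := by
  simp only [fourier_eq_sum]
  refine Finsupp.sum_add_index' (by simp) (fun t p q => ?_)
  simp only [Prod.fst_add, Prod.snd_add]; ring

theorem fourier_sub (μ ν : SpikeDistribution) (k : ℕ) :
    (μ - ν).fourier k = μ.fourier k - ν.fourier k := by
  rw [eq_sub_iff_add_eq, ← fourier_add, sub_add_cancel]

theorem fourier_finset_sum {ι : Type*} (s : Finset ι) (μ : ι → SpikeDistribution) (k : ℕ) :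
    fourier (∑ i ∈ s, μ i) k = ∑ i ∈ s, (μ i).fourier k := by
  classical
  induction s using Finset.induction_on with
  | empty => simp [fourier_eq_sum]
  | insert i s hi ih => rw [Finset.sum_insert hi, Finset.sum_insert hi, fourier_add, ih]

theorem fourier_single (t : ℝ) (p : ℂ × ℂ) (k : ℕ) :
    fourier (Finsupp.single t p) k = (p.1 + p.2 * (Complex.I * k)) * unitNode t ^ k := by
  rw [fourier_eq_sum, Finsupp.sum_single_index (by simp)]

theorem norm_fst_le_l2norm (μ : SpikeDistribution) (t : ℝ) : ‖(μ t).1‖ ≤ μ.l2norm := by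
  by_cases ht : t ∈ μ.support
  · refine Real.le_sqrt_of_sq_le ?_
    refine le_trans ?_ (Finset.single_le_sum
      (f := fun t => ‖(μ t).1‖ ^ 2 + ‖(μ t).2‖ ^ 2) (fun _ _ => by positivity) ht)
    nlinarith [sq_nonneg ‖(μ t).2‖]
  · rw [Finsupp.notMem_support_iff.1 ht]; simp [l2norm, Real.sqrt_nonneg]

theorem l2norm_le (μ : SpikeDistribution) {n : ℕ} {B : ℝ} (hn : μ.support.card ≤ n)
    (h1 : ∀ t ∈ μ.support, ‖(μ t).1‖ ≤ B) (h2 : ∀ t ∈ μ.support, ‖(μ t).2‖ ≤ B) (hB : 0 ≤ B) :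
    μ.l2norm ≤ √(2 * n) * B := by
  have : ∑ t ∈ μ.support, (‖(μ t).1‖ ^ 2 + ‖(μ t).2‖ ^ 2) ≤ (2 * n) * B ^ 2 := by
    calc _ ≤ ∑ t ∈ μ.support, (B ^ 2 + B ^ 2) := by
          refine Finset.sum_le_sum fun t ht => ?_
          gcongr
          exacts [h1 t ht, h2 t ht]
      _ = μ.support.card * (2 * B ^ 2) := by rw [Finset.sum_const, nsmul_eq_mul]; ring
      _ ≤ n * (2 * B ^ 2) := by gcongr
      _ = _ := by ring
  refine (Real.sqrt_le_sqrt this).trans ?_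
  rw [Real.sqrt_mul (by positivity), Real.sqrt_sq hB]

end SpikeDistribution


/-! ### Polynomials as test functionals on the data. -/

section

open Polynomial

/-- The vector of the first `D` coefficients of a polynomial. -/
noncomputable def coeffVec (D : ℕ) (P : ℂ[X]) : EuclideanSpace ℂ (Fin D) := WithLp.toLp 2 fun k => P.coeff k

theorem coeffVec_add (D : ℕ) (P R : ℂ[X]) : coeffVec D (P + R) = coeffVec D P + coeffVec D R := by
  ext k; simp [coeffVec]

theorem coeffVec_C_mul (D : ℕ) (a : ℂ) (P : ℂ[X]) : coeffVec D (C a * P) = a • coeffVec D P := by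
  ext k; simp [coeffVec]

theorem norm_coeffVec_X_pow_mul_le (D q : ℕ) (P : ℂ[X]) :
    ‖coeffVec D (X ^ q * P)‖ ≤ ‖coeffVec D P‖ := by
  rw [EuclideanSpace.norm_eq, EuclideanSpace.norm_eq]
  refine Real.sqrt_le_sqrt ?_
  simp only [coeffVec, coeff_X_pow_mul']
  rw [Fin.sum_univ_eq_sum_range (fun k => ‖if q ≤ k then P.coeff (k - q) else 0‖ ^ 2),
    Fin.sum_univ_eq_sum_range (fun k => ‖P.coeff k‖ ^ 2)]
  rcases le_total D q with h | h
  · rw [Finset.sum_eq_zero]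
    · positivity
    · intro k hk
      rw [if_neg (by have := Finset.mem_range.1 hk; omega)]; simp
  · obtain ⟨r, rfl⟩ := Nat.exists_eq_add_of_le h
    rw [Finset.sum_range_add, Finset.sum_eq_zero, zero_add]
    · simp only [le_add_iff_nonneg_right, zero_le, if_true, Nat.add_sub_cancel_left]
      exact Finset.sum_le_sum_of_subset_of_nonneg (Finset.range_mono (by omega))
        fun _ _ _ => by positivity
    · intro k hk
      rw [if_neg (by have := Finset.mem_range.1 hk; omega)]; simp

/-- Multiplication by X^q is a truncated shift of coefficients, so the cost of a binomial does not
depend on q. -/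
theorem norm_coeffVec_binomial_mul_le (D q : ℕ) (a b : ℂ) (P : ℂ[X]) :
    ‖coeffVec D ((C a * X ^ q + C b) * P)‖ ≤ (‖a‖ + ‖b‖) * ‖coeffVec D P‖ := by
  rw [add_mul, mul_assoc, coeffVec_add, coeffVec_C_mul, coeffVec_C_mul, add_mul]
  refine (norm_add_le _ _).trans ?_
  rw [norm_smul, norm_smul]
  gcongr
  exact norm_coeffVec_X_pow_mul_le D q P

/-- Pairing a distribution with a trigonometric polynomial. -/
theorem SpikeDistribution.sum_coeff_mul_fourier (μ : SpikeDistribution) {N : ℕ} {P : ℂ[X]}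
    (hP : P.natDegree ≤ 2 * N) :
    ∑ k : Fin (2 * N + 1), P.coeff k * μ.fourier k =
      ∑ t ∈ μ.support, ((μ t).1 * P.eval (unitNode t) +
        (μ t).2 * (Complex.I * unitNode t * (derivative P).eval (unitNode t))) := by
  rw [Fin.sum_univ_eq_sum_range (fun k => P.coeff k * μ.fourier k)]
  simp only [fourier_eq_sum, Finsupp.sum, Finset.mul_sum]
  rw [Finset.sum_comm]
  refine Finset.sum_congr rfl fun t _ => ?_
  have hd : (Complex.I * unitNode t * (derivative P).eval (unitNode t)) =
      ∑ k ∈ Finset.range (2 * N + 1), P.coeff k * (Complex.I * k) * unitNode t ^ k := by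
    rw [derivative_eval, Polynomial.sum_over_range' P (by simp) (2 * N + 1) (by omega),
      Finset.mul_sum]
    refine Finset.sum_congr rfl fun k _ => ?_
    rcases k with _ | k
    · simp
    · simp only [Nat.add_sub_cancel]; ring
  rw [hd, eval_eq_sum_range' (show P.natDegree < 2 * N + 1 by omega), Finset.mul_sum,
    Finset.mul_sum, ← Finset.sum_add_distrib]
  refine Finset.sum_congr rfl fun k _ => ?_
  ring

theorem SpikeDistribution.norm_sum_coeff_mul_fourier_le (μ : SpikeDistribution) (N : ℕ) (P : ℂ[X]) :
    ‖∑ k : Fin (2 * N + 1), P.coeff k * μ.fourier k‖ ≤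
      ‖coeffVec (2 * N + 1) P‖ * √(∑ k : Fin (2 * N + 1), ‖μ.fourier k‖ ^ 2) := by
  refine (norm_sum_le _ _).trans ?_
  simp only [norm_mul]
  refine (Real.sum_mul_le_sqrt_mul_sqrt _ _ _).trans (le_of_eq ?_)
  rw [EuclideanSpace.norm_eq]; rfl

/-! ### Separating powers, dual polynomials and the stability estimate. -/

theorem norm_unitNode_pow_sub (t u : ℝ) (q : ℕ) :
    ‖unitNode t ^ q - unitNode u ^ q‖ = 2 * |Real.sin (q * |t - u| / 2)| := by
  have h : unitNode t ^ q - unitNode u ^ q =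
      unitNode u ^ q * (Complex.exp (Complex.I * ((q * (u - t) : ℝ) : ℂ)) - 1) := by
    simp only [unitNode, ← Complex.exp_nat_mul, mul_sub, ← Complex.exp_add]
    congr 2
    · push_cast; ring_nf
    · simp
  rw [h, norm_mul, norm_pow, norm_unitNode, one_pow, one_mul,
    Complex.norm_exp_I_mul_ofReal_sub_one, norm_mul, Real.norm_eq_abs, Real.norm_eq_abs]
  rcases abs_cases (t - u) with ⟨h, _⟩ | ⟨h, _⟩
  · rw [h, show (q * (u - t) / 2 : ℝ) = -(q * (t - u) / 2) by ring, Real.sin_neg, abs_neg]; simp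
  · rw [h]; simp

/-- A power `q ≤ Q` separating two nodes of the circle as well as possible. -/
theorem exists_pow_separating {t u D : ℝ} {Q : ℕ} (hd : 0 < |t - u|)
    (hπ : |t - u| ≤ π) (hD1 : D ≤ 1) (hD : D ≤ 2 / π * (Q * |t - u|)) :
    ∃ q ≤ Q, D ≤ ‖unitNode t ^ q - unitNode u ^ q‖ := by
  have hpi := Real.pi_pos
  have key : ∀ q : ℕ, q * |t - u| ≤ π →
      2 / π * (q * |t - u|) ≤ ‖unitNode t ^ q - unitNode u ^ q‖ := by
    intro q hq
    rw [norm_unitNode_pow_sub]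
    have := Real.mul_le_sin (x := q * |t - u| / 2) (by positivity) (by linarith)
    have h2 := le_abs_self (Real.sin (q * |t - u| / 2))
    linarith
  -- Jordan's inequality controls the chord up to angle π. If the power Q overshoots, the largest q
  -- with angle at most π has angle at least π/2, hence chord at least 1.
  by_cases h : Q * |t - u| ≤ π
  · exact ⟨Q, le_rfl, hD.trans (key Q h)⟩
  · push Not at h
    have hfl : (⌊π / |t - u|⌋₊ : ℝ) * |t - u| ≤ π := by
      have := Nat.floor_le (show 0 ≤ π / |t - u| by positivity)
      rwa [le_div_iff₀ hd] at this
    refine ⟨⌊π / |t - u|⌋₊, ?_, hD1.trans (le_trans ?_ (key _ hfl))⟩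
    · have : π / |t - u| ≤ Q := by rw [div_le_iff₀ hd]; exact h.le
      exact (Nat.floor_le_floor this).trans (by simp)
    · have h1 : (1 : ℝ) ≤ ⌊π / |t - u|⌋₊ := by
        have : 1 ≤ ⌊π / |t - u|⌋₊ := Nat.le_floor (by rw [Nat.cast_one, le_div_iff₀ hd]; linarith)
        exact_mod_cast this
      have h2 := Nat.lt_floor_add_one (π / |t - u|)
      rw [div_lt_iff₀ hd] at h2
      have h3 : π ≤ 2 * (⌊π / |t - u|⌋₊ * |t - u|) := by nlinarith
      calc (1 : ℝ) = 1 / π * π := by field_simp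
        _ ≤ 1 / π * (2 * (⌊π / |t - u|⌋₊ * |t - u|)) := by gcongr
        _ = _ := by ring

/-- A product of binomials equal to one at `z` and vanishing at the points `w u`, with control of
its derivative and of the norm of multiplication by it. -/
theorem exists_interpolating_product {ι : Type*} (S : Finset ι) (z : ℂ) (w : ι → ℂ) (D : ι → ℝ)
    (Q : ℕ) (hz : ‖z‖ = 1) (hw : ∀ u ∈ S, ‖w u‖ = 1) (hD : ∀ u ∈ S, 0 < D u)
    (hsep : ∀ u ∈ S, ∃ q ≤ Q, D u ≤ ‖z ^ q - w u ^ q‖) :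
    ∃ G : ℂ[X], G.natDegree ≤ S.card * Q ∧ G.eval z = 1 ∧ (∀ u ∈ S, G.eval (w u) = 0) ∧
      ‖(derivative G).eval z‖ ≤ Q * ∑ u ∈ S, (D u)⁻¹ ∧
      ∀ (n : ℕ) (P : ℂ[X]), ‖coeffVec n (G * P)‖ ≤ (∏ u ∈ S, 2 / D u) * ‖coeffVec n P‖ := by
  classical
  induction S using Finset.induction_on with
  | empty => exact ⟨1, by simp⟩
  | insert u S hu ih =>
    obtain ⟨G, hdeg, h1, h0, hder, hn⟩ := ih (fun v hv => hw v (Finset.mem_insert_of_mem hv))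
      (fun v hv => hD v (Finset.mem_insert_of_mem hv))
      (fun v hv => hsep v (Finset.mem_insert_of_mem hv))
    obtain ⟨q, hq, hDq⟩ := hsep u (Finset.mem_insert_self _ _)
    have hDu := hD u (Finset.mem_insert_self _ _)
    have hwu := hw u (Finset.mem_insert_self _ _)
    have hpos : 0 < ‖z ^ q - w u ^ q‖ := hDu.trans_le hDq
    have hne : z ^ q - w u ^ q ≠ 0 := norm_pos_iff.1 hpos
    set c := (z ^ q - w u ^ q)⁻¹ with hc
    have hcn : ‖c‖ ≤ (D u)⁻¹ := by
      rw [hc, norm_inv]; exact inv_anti₀ hDu hDq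
    -- The binomial (X^q - w^q)/(z^q - w^q): its coefficients have total size at most 2/D, and its
    -- derivative at z is at most Q/D.
    set F : ℂ[X] := C c * X ^ q + C (-c * w u ^ q) with hF
    have hFz : F.eval z = 1 := by
      simp only [hF, eval_add, eval_mul, eval_C, eval_pow, eval_X]
      rw [show c * z ^ q + -c * w u ^ q = c * (z ^ q - w u ^ q) by ring, hc, inv_mul_cancel₀ hne]
    have hFu : F.eval (w u) = 0 := by
      simp only [hF, eval_add, eval_mul, eval_C, eval_pow, eval_X]; ring
    have hFd : ‖(derivative F).eval z‖ ≤ Q * (D u)⁻¹ := by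
      simp only [hF, derivative_add, derivative_C_mul, derivative_X_pow, derivative_C, add_zero,
        eval_mul, eval_C, eval_pow, eval_X, norm_mul, norm_pow, hz, one_pow, mul_one,
        eval_natCast, map_natCast]
      rw [mul_comm, Complex.norm_natCast]
      gcongr
    have hFdeg : F.natDegree ≤ q := by
      refine natDegree_add_le_of_degree_le (natDegree_C_mul_X_pow_le _ _) ?_
      rw [natDegree_C]; exact Nat.zero_le _
    refine ⟨F * G, ?_, ?_, ?_, ?_, ?_⟩
    · rw [Finset.card_insert_of_notMem hu]
      refine natDegree_mul_le.trans ?_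
      rw [add_mul, one_mul, add_comm]
      omega
    · rw [eval_mul, hFz, h1, one_mul]
    · intro v hv
      rw [eval_mul]
      rcases Finset.mem_insert.1 hv with rfl | hv
      · rw [hFu, zero_mul]
      · rw [h0 v hv, mul_zero]
    · rw [derivative_mul, eval_add, eval_mul, eval_mul, h1, hFz, mul_one, one_mul,
        Finset.sum_insert hu, mul_add]
      exact (norm_add_le _ _).trans (add_le_add hFd hder)
    · intro n P
      rw [Finset.prod_insert hu, mul_assoc F, mul_assoc]
      refine (norm_coeffVec_binomial_mul_le n q _ _ _).trans ?_
      refine mul_le_mul ?_ (hn n P) (norm_nonneg _) (by positivity)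
      rw [norm_mul, norm_neg, norm_pow, hwu, one_pow, mul_one, div_eq_mul_inv]
      linarith

/-- The averaged geometric polynomial peaking at `z`. -/
theorem exists_peak_polynomial (z : ℂ) (hz : ‖z‖ = 1) {Q : ℕ} (hQ : 1 ≤ Q) :
    ∃ K : ℂ[X], K.natDegree ≤ Q ∧ K.eval z = 1 ∧ ‖(derivative K).eval z‖ ≤ Q ∧
      ∀ n : ℕ, ‖coeffVec n K‖ ≤ (√Q)⁻¹ := by
  have hz0 : z ≠ 0 := by rintro rfl; simp at hz
  have hQ0 : (Q : ℂ) ≠ 0 := by exact_mod_cast (by omega : Q ≠ 0)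
  have hQr : (0 : ℝ) < Q := by exact_mod_cast hQ
  -- Coefficients of equal modulus 1/Q, in phase at z: by Cauchy–Schwarz the smallest ℓ² norm that Q
  -- coefficients allow for value 1 at z.
  refine ⟨∑ k ∈ Finset.range Q, C ((Q : ℂ)⁻¹ * (z ^ k)⁻¹) * X ^ k, ?_, ?_, ?_, ?_⟩
  · refine natDegree_sum_le_of_forall_le _ _ fun k hk => (natDegree_C_mul_X_pow_le _ _).trans ?_
    exact (Finset.mem_range.1 hk).le
  · simp only [eval_finsetSum, eval_mul, eval_C, eval_pow, eval_X]
    rw [Finset.sum_congr rfl (g := fun _ => (Q : ℂ)⁻¹) fun k _ => by field_simp]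
    simp [hQ0]
  · simp only [derivative_sum, derivative_C_mul, derivative_X_pow, eval_finsetSum, eval_mul,
      eval_C, eval_pow, eval_X, map_natCast, eval_natCast]
    refine (norm_sum_le_of_le (f := _) (n := fun _ => (1 : ℝ)) _ fun k hk => ?_).trans (by simp)
    simp only [norm_mul, norm_inv, norm_pow, hz, one_pow, Complex.norm_natCast, mul_one, inv_one]
    rw [inv_mul_le_iff₀ hQr, mul_one]
    exact_mod_cast (Finset.mem_range.1 hk).le
  · intro n
    rw [EuclideanSpace.norm_eq, ← Real.sqrt_inv]
    refine Real.sqrt_le_sqrt ?_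
    simp only [coeffVec, finsetSum_coeff, coeff_C_mul, coeff_X_pow, mul_ite, mul_one, mul_zero,
      Finset.sum_ite_eq, Finset.mem_range]
    rw [Fin.sum_univ_eq_sum_range
      (fun k => ‖if k < Q then (Q : ℂ)⁻¹ * (z ^ k)⁻¹ else 0‖ ^ 2)]
    calc _ ≤ ∑ k ∈ Finset.range n, if k < Q then ((Q : ℝ)⁻¹) ^ 2 else 0 := by
          refine Finset.sum_le_sum fun k _ => ?_
          split_ifs <;> simp [hz]
      _ ≤ (Q : ℝ) * ((Q : ℝ)⁻¹) ^ 2 := by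
          rw [← Finset.sum_filter, Finset.sum_const, nsmul_eq_mul]
          gcongr
          have : (Finset.range n).filter (· < Q) ⊆ Finset.range Q := by
            intro k hk; simp at hk ⊢; exact hk.2
          simpa using Finset.card_le_card this
      _ = _ := by field_simp

/-- Hermite interpolation polynomials at `z`, with a second order zero at the other nodes. -/
theorem exists_dual_polynomials {ι : Type*} (S : Finset ι) (z : ℂ) (w : ι → ℂ) (D : ι → ℝ)
    {Q : ℕ} (hQ : 1 ≤ Q) (hz : ‖z‖ = 1) (hw : ∀ u ∈ S, ‖w u‖ = 1) (hD : ∀ u ∈ S, 0 < D u)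
    (hsep : ∀ u ∈ S, ∃ q ≤ Q, D u ≤ ‖z ^ q - w u ^ q‖) :
    ∃ A B : ℂ[X], A.natDegree ≤ (2 * S.card + 2) * Q ∧ B.natDegree ≤ (2 * S.card + 2) * Q ∧
      (∀ u ∈ S, A.eval (w u) = 0 ∧ (derivative A).eval (w u) = 0 ∧
        B.eval (w u) = 0 ∧ (derivative B).eval (w u) = 0) ∧
      A.eval z = 1 ∧ (derivative A).eval z = 0 ∧
      B.eval z = 0 ∧ Complex.I * z * (derivative B).eval z = 1 ∧
      (∀ n, ‖coeffVec n A‖ ≤ (3 + 4 * ∑ u ∈ S, (D u)⁻¹) * ((∏ u ∈ S, 2 / D u) ^ 2 * (√Q)⁻¹)) ∧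
      ∀ n, ‖coeffVec n B‖ ≤ 2 * ((∏ u ∈ S, 2 / D u) ^ 2 * (√Q)⁻¹) := by
  have hz0 : z ≠ 0 := by rintro rfl; simp at hz
  have hQ0 : (Q : ℂ) ≠ 0 := by exact_mod_cast (by omega : Q ≠ 0)
  have hQr : (1 : ℝ) ≤ Q := by exact_mod_cast hQ
  obtain ⟨G, hGdeg, hG1, hG0, hGder, hGn⟩ := exists_interpolating_product S z w D Q hz hw hD hsep
  obtain ⟨K, hKdeg, hK1, hKder, hKn⟩ := exists_peak_polynomial z hz hQ
  set p := ∏ u ∈ S, 2 / D u with hp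
  have hp0 : 0 ≤ p := Finset.prod_nonneg fun u hu => by have := hD u hu; positivity
  -- G twice for the double zeros, K once for the gain Q^{-1/2}; a last binomial in X^Q will
  -- prescribe the value and derivative at z.
  set R := G * (G * K) with hR
  have hRdeg : R.natDegree ≤ (2 * S.card + 1) * Q := by
    refine natDegree_mul_le.trans ?_
    have := natDegree_mul_le (p := G) (q := K)
    nlinarith
  have hRn : ∀ n, ‖coeffVec n R‖ ≤ p ^ 2 * (√Q)⁻¹ := fun n => by
    refine (hGn n _).trans ?_
    rw [pow_two, mul_assoc]
    exact mul_le_mul_of_nonneg_left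
      ((hGn n K).trans (mul_le_mul_of_nonneg_left (hKn n) hp0)) hp0
  have hR1 : R.eval z = 1 := by simp [hR, hG1, hK1]
  have hRu : ∀ u ∈ S, R.eval (w u) = 0 := fun u hu => by simp [hR, hG0 u hu]
  have hRdu : ∀ u ∈ S, (derivative R).eval (w u) = 0 := fun u hu => by
    simp [hR, hG0 u hu, derivative_mul]
  set r := (derivative R).eval z with hr
  have hrn : ‖r‖ ≤ Q * (1 + 2 * ∑ u ∈ S, (D u)⁻¹) := by
    have : r = (derivative G).eval z + ((derivative G).eval z + (derivative K).eval z) := by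
      simp [hr, hR, derivative_mul, hG1, hK1]
    rw [this]
    refine (norm_add_le _ _).trans ((add_le_add le_rfl (norm_add_le _ _)).trans ?_)
    linarith
  have hbin : ∀ c d : ℂ, (C c * X ^ Q + C d : ℂ[X]).natDegree ≤ Q := fun c d => by
    refine natDegree_add_le_of_degree_le (natDegree_C_mul_X_pow_le _ _) ?_
    rw [natDegree_C]; exact Nat.zero_le _
  have hdeg : ∀ c d : ℂ, ((C c * X ^ Q + C d) * R).natDegree ≤ (2 * S.card + 2) * Q :=
    fun c d => by
      refine natDegree_mul_le.trans ?_
      have := hbin c d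
      linarith
  have hpow : z ^ Q = z * z ^ (Q - 1) := by rw [← pow_succ', Nat.sub_add_cancel hQ]
  have hev : ∀ c d : ℂ, ((C c * X ^ Q + C d) * R).eval z = c * z ^ Q + d := fun c d => by
    simp [hR1]
  have hder : ∀ c d : ℂ, z * (derivative ((C c * X ^ Q + C d) * R)).eval z =
      c * Q * z ^ Q + (c * z ^ Q + d) * (z * r) := fun c d => by
    simp only [derivative_mul, derivative_add, derivative_C, derivative_X_pow, eval_zero,
      eval_add, eval_mul, eval_C, eval_pow, eval_X, hR1, hpow, ← hr, map_natCast, eval_natCast]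
    ring
  have hzero : ∀ c d : ℂ, ∀ u ∈ S, ((C c * X ^ Q + C d) * R).eval (w u) = 0 ∧
      (derivative ((C c * X ^ Q + C d) * R)).eval (w u) = 0 := fun c d u hu => by
    simp [derivative_mul, hRu u hu, hRdu u hu]
  -- The factor γ z^{-Q} X^Q + 1 - γ has value 1 and derivative γQ/z at z, which cancels r. Since r
  -- is O(Q ∑ 1/D), γ is only O(1 + ∑ 1/D). For B the factor (z^{-Q} X^Q - 1)/(iQ) vanishes at z
  -- with the right slope.
  set γ : ℂ := -(z * r) / Q with hγ
  have hγn : ‖γ‖ ≤ 1 + 2 * ∑ u ∈ S, (D u)⁻¹ := by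
    rw [hγ, norm_div, norm_neg, norm_mul, hz, one_mul, Complex.norm_natCast,
      div_le_iff₀ (by linarith), mul_comm]
    exact hrn
  have hzQ : z ^ Q ≠ 0 := pow_ne_zero _ hz0
  refine ⟨(C (γ / z ^ Q) * X ^ Q + C (1 - γ)) * R,
    (C ((Complex.I * Q)⁻¹ / z ^ Q) * X ^ Q + C (-(Complex.I * Q)⁻¹)) * R, hdeg _ _, hdeg _ _,
    fun u hu => ⟨(hzero _ _ u hu).1, (hzero _ _ u hu).2, (hzero _ _ u hu).1, (hzero _ _ u hu).2⟩,
    ?_, ?_, ?_, ?_, fun n => ?_, fun n => ?_⟩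
  · rw [hev, div_mul_cancel₀ _ hzQ]; ring
  · refine (mul_eq_zero.1 (?_ : z * _ = 0)).resolve_left hz0
    rw [hder, mul_right_comm, div_mul_cancel₀ _ hzQ, hγ]
    field_simp
    ring
  · rw [hev, div_mul_cancel₀ _ hzQ]; ring
  · rw [mul_assoc, hder, mul_right_comm, div_mul_cancel₀ _ hzQ]
    have := Complex.I_ne_zero
    field_simp
    ring
  · refine (norm_coeffVec_binomial_mul_le n Q _ _ _).trans ?_
    refine mul_le_mul ?_ (hRn n) (norm_nonneg _) ?_
    · rw [norm_div, norm_pow, hz, one_pow, div_one]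
      have := norm_sub_le (1 : ℂ) γ
      rw [norm_one] at this
      linarith
    · have : 0 ≤ ∑ u ∈ S, (D u)⁻¹ :=
        Finset.sum_nonneg fun u hu => by have := hD u hu; positivity
      positivity
  · refine (norm_coeffVec_binomial_mul_le n Q _ _ _).trans ?_
    refine mul_le_mul ?_ (hRn n) (norm_nonneg _) (by norm_num)
    rw [norm_div, norm_pow, hz, one_pow, div_one, norm_neg, norm_inv, norm_mul, Complex.norm_I,
      one_mul, Complex.norm_natCast]
    have : (Q : ℝ)⁻¹ ≤ 1 := inv_le_one_of_one_le₀ hQr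
    linarith

/-- Testing against the dual polynomials of a node isolates its two amplitudes. The m close nodes
contribute δ⁻¹ twice each, the far ones only constants, and the derivative correction contributes
one further δ⁻¹. -/
theorem SpikeDistribution.l2norm_le_of_separated (μ : SpikeDistribution) {s m Q N : ℕ} {δ : ℝ}
    (far : ℝ → ℝ → Prop) (hQ : 1 ≤ Q) (hs : 1 ≤ s) (hQN : 2 * s * Q ≤ N) (hδ : 0 < δ) (hδ1 : δ ≤ 1)
    (hcard : μ.support.card ≤ 2 * s)
    (hsep : ∀ t ∈ μ.support, ∀ u ∈ μ.support, t ≠ u →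
      ∃ q ≤ Q, δ ≤ ‖unitNode t ^ q - unitNode u ^ q‖)
    (hfar : ∀ t ∈ μ.support, ∀ u ∈ μ.support, t ≠ u → far t u →
      ∃ q ≤ Q, 1 ≤ ‖unitNode t ^ q - unitNode u ^ q‖)
    (hclose : ∀ t ∈ μ.support, {u ∈ (μ.support : Set ℝ) | u ≠ t ∧ ¬ far t u}.ncard ≤ m) :
    μ.l2norm ≤ √(4 * s) * (11 * s * δ⁻¹ * (16 ^ s * (δ⁻¹ ^ m) ^ 2 * (√Q)⁻¹) *
      √(∑ k : Fin (2 * N + 1), ‖μ.fourier k‖ ^ 2)) := by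
  classical
  have hsr : (1 : ℝ) ≤ s := by exact_mod_cast hs
  have hδi : 1 ≤ δ⁻¹ := (one_le_inv₀ hδ).2 hδ1
  set E := √(∑ k : Fin (2 * N + 1), ‖μ.fourier k‖ ^ 2)
  have key : ∀ t ∈ μ.support,
      ‖(μ t).1‖ ≤ 11 * s * δ⁻¹ * (16 ^ s * (δ⁻¹ ^ m) ^ 2 * (√Q)⁻¹) * E ∧
      ‖(μ t).2‖ ≤ 11 * s * δ⁻¹ * (16 ^ s * (δ⁻¹ ^ m) ^ 2 * (√Q)⁻¹) * E := by
    intro t ht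
    set D : ℝ → ℝ := fun u => if far t u then 1 else δ with hD
    have hDδ : ∀ u, (D u)⁻¹ ≤ δ⁻¹ := fun u => by
      simp only [hD]; split_ifs <;> simp [hδi]
    have hD0 : ∀ u, 0 < D u := fun u => by simp only [hD]; split_ifs <;> simp [hδ]
    set S := μ.support.erase t with hS
    have hScard : S.card + 1 ≤ 2 * s := by
      rw [hS, Finset.card_erase_add_one ht]; exact hcard
    obtain ⟨A, B, hAd, hBd, hzero, hA1, hA0, hB0, hB1, hAn, hBn⟩ :=
      exists_dual_polynomials S (unitNode t) unitNode D hQ (norm_unitNode t)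
        (fun u _ => norm_unitNode u) (fun u _ => hD0 u) (fun u hu => by
          have hu' := Finset.mem_erase.1 hu
          simp only [hD]
          split_ifs with h
          · exact hfar t ht u hu'.2 hu'.1.symm h
          · exact hsep t ht u hu'.2 hu'.1.symm)
    have hsum : ∑ u ∈ S, (D u)⁻¹ ≤ 2 * s * δ⁻¹ := by
      refine (Finset.sum_le_card_nsmul S _ δ⁻¹ fun u _ => hDδ u).trans ?_
      rw [nsmul_eq_mul]
      gcongr
      exact_mod_cast (by omega : S.card ≤ 2 * s)
    have hclose' : (S.filter fun u => ¬ far t u).card ≤ m := by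
      rw [← Set.ncard_coe_finset]
      convert hclose t ht using 2
      ext u; simp [hS]; tauto
    have hprod : ∏ u ∈ S, 2 / D u ≤ 4 ^ s * δ⁻¹ ^ m := by
      simp only [div_eq_mul_inv, Finset.prod_mul_distrib, Finset.prod_const]
      have h1 : (2 : ℝ) ^ S.card ≤ 4 ^ s := by
        rw [show (4 : ℝ) = 2 ^ 2 by norm_num, ← pow_mul]
        exact pow_le_pow_right₀ (by norm_num) (by omega)
      have h2 : ∏ u ∈ S, (D u)⁻¹ = δ⁻¹ ^ (S.filter fun u => ¬ far t u).card := by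
        rw [← Finset.prod_const, Finset.prod_filter]
        refine Finset.prod_congr rfl fun u _ => ?_
        simp only [hD]; by_cases h : far t u <;> simp [h]
      rw [h2]
      gcongr
    have hprod2 : (∏ u ∈ S, 2 / D u) ^ 2 ≤ 16 ^ s * (δ⁻¹ ^ m) ^ 2 := by
      have h0 : 0 ≤ ∏ u ∈ S, 2 / D u :=
        Finset.prod_nonneg fun u _ => by have := hD0 u; positivity
      refine (pow_le_pow_left₀ h0 hprod 2).trans (le_of_eq ?_)
      rw [mul_pow, ← pow_mul, mul_comm s 2, pow_mul]; norm_num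
    -- With at most 2s - 1 other nodes the degree is at most 4sQ, which explains the assumption 2sQ
    -- ≤ N.
    have hdeg : (2 * S.card + 2) * Q ≤ 2 * N := by
      have : (2 * S.card + 2) * Q ≤ (4 * s) * Q := Nat.mul_le_mul_right _ (by omega)
      linarith
    -- Gives 3 + 4 · 2sδ⁻¹ ≤ 11sδ⁻¹, the source of the 11; it also covers the constant 2 for B.
    have hsδ : 1 ≤ s * δ⁻¹ := one_le_mul_of_one_le_of_one_le hsr hδi
    have hpair : ∀ P : ℂ[X], P.natDegree ≤ 2 * N →
        (∀ u ∈ S, P.eval (unitNode u) = 0 ∧ (derivative P).eval (unitNode u) = 0) →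
        ∑ k : Fin (2 * N + 1), P.coeff k * μ.fourier k = (μ t).1 * P.eval (unitNode t) +
          (μ t).2 * (Complex.I * unitNode t * (derivative P).eval (unitNode t)) := by
      intro P hP h0
      rw [μ.sum_coeff_mul_fourier hP]
      refine Finset.sum_eq_single_of_mem t ht fun u hu hut => ?_
      obtain ⟨h1, h2⟩ := h0 u (Finset.mem_erase.2 ⟨hut, hu⟩)
      rw [h1, h2]; simp
    have hA := hpair A (hAd.trans hdeg) fun u hu => ⟨(hzero u hu).1, (hzero u hu).2.1⟩
    have hB := hpair B (hBd.trans hdeg) fun u hu => (hzero u hu).2.2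
    rw [hA1, hA0] at hA
    rw [hB0, hB1] at hB
    constructor
    · have h := μ.norm_sum_coeff_mul_fourier_le N A
      rw [hA, mul_one, mul_zero, mul_zero, add_zero] at h
      refine h.trans ?_
      gcongr
      refine (hAn _).trans ?_
      gcongr
      linarith
    · have h := μ.norm_sum_coeff_mul_fourier_le N B
      rw [hB, mul_one, mul_zero, zero_add] at h
      refine h.trans ?_
      gcongr
      refine (hBn _).trans ?_
      gcongr
      linarith
  have := μ.l2norm_le hcard (fun t ht => (key t ht).1) (fun t ht => (key t ht).2) (by positivity)
  refine this.trans (le_of_eq ?_)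
  congr 2
  push_cast; ring

/-! ### Distances in clustered grid configurations. -/

theorem wrapDist_eq_abs {t : ℝ} (ht : |t| < π) : wrapDist t = |t| := by
  have h := abs_lt.1 ht
  have him : ((t : ℂ) * Complex.I).im = t := by simp
  rw [wrapDist, Complex.arg_exp, him, (toIocMod_eq_self _).2 ⟨h.1, by linarith⟩]

theorem abs_sub_lt_pi {t u : ℝ} (ht : t ∈ Set.Ioc (-(π / 2)) (π / 2))
    (hu : u ∈ Set.Ioc (-(π / 2)) (π / 2)) : |t - u| < π := by
  rw [abs_lt]; constructor <;> linarith [ht.1, ht.2, hu.1, hu.2]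

theorem le_abs_sub_of_mem_grid {Δ t u : ℝ} (hΔ : 0 < Δ) (ht : t ∈ grid Δ) (hu : u ∈ grid Δ)
    (h : t ≠ u) : Δ ≤ |t - u| := by
  obtain ⟨k, _, _, rfl⟩ := ht
  obtain ⟨j, _, _, rfl⟩ := hu
  have hkj : k - j ≠ 0 := by
    intro h0; apply h; rw [sub_eq_zero.1 h0]
  rw [← sub_mul, abs_mul, abs_of_pos hΔ]
  have : (1 : ℝ) ≤ |(k : ℝ) - j| := by exact_mod_cast Int.one_le_abs hkj
  nlinarith

/-- A clustered configuration has at most `ℓ` nodes at distance less than `ρ / 2` of a point. -/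
theorem IsClustered.card_close_le {Δ ρ τ : ℝ} {s ℓ : ℕ} {x : Finset ℝ}
    (hx : IsClustered Δ ρ s ℓ τ x) (hρ : ℓ < s → 0 < ρ) (t : ℝ) :
    {u ∈ (x : Set ℝ) | ¬ (0 < ρ ∧ ρ / 2 ≤ |t - u|)}.ncard ≤ ℓ := by
  by_cases h : 0 < ρ
  · rcases Set.eq_empty_or_nonempty {u ∈ (x : Set ℝ) | ¬ (0 < ρ ∧ ρ / 2 ≤ |t - u|)} with he | ⟨v, hv⟩
    · rw [he]; simp
    · obtain ⟨c, hcx, -, hcard, -, hout⟩ := hx.cluster v hv.1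
      have hsub : {u ∈ (x : Set ℝ) | ¬ (0 < ρ ∧ ρ / 2 ≤ |t - u|)} ⊆ c := by
        intro u hu
        by_contra huc
        have h1 := hout u hu.1 huc
        rw [wrapDist_eq_abs (abs_sub_lt_pi (hx.mem_Ioc u hu.1) (hx.mem_Ioc v hv.1))] at h1
        have h2 := hu.2
        have h3 := hv.2
        simp only [h, true_and, not_le] at h2 h3
        have := abs_sub_le u t v
        rw [abs_sub_comm u t] at this
        linarith
      exact (Set.ncard_le_ncard hsub c.finite_toSet).trans (by rwa [Set.ncard_coe_finset])
  · have : ¬ ℓ < s := fun hl => h (hρ hl)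
    refine (Set.ncard_le_ncard (fun u hu => hu.1) x.finite_toSet).trans ?_
    rw [Set.ncard_coe_finset, hx.card_eq]; omega

/-! ### The upper bound. -/

theorem sqrt_sum_le_of_mem_dataBall {N : ℕ} {ε : ℝ} (hN : 1 ≤ N) {μ ν : SpikeDistribution}
    {y : Fin (2 * N + 1) → ℂ} (hμ : y ∈ dataBall N ε μ) (hν : y ∈ dataBall N ε ν) :
    √(∑ k : Fin (2 * N + 1), ‖(ν - μ).fourier k‖ ^ 2) ≤ 2 * ε * √(2 * N) := by
  have hN' : (0 : ℝ) < 2 * N := by positivity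
  have key : ∀ κ : SpikeDistribution, y ∈ dataBall N ε κ →
      ‖(WithLp.toLp 2 fun k => y k - κ.fourier k : EuclideanSpace ℂ (Fin (2 * N + 1)))‖ ≤
        ε * √(2 * N) := by
    intro κ hκ
    have h : √(1 / (2 * (N : ℝ)) * ∑ k : Fin (2 * N + 1), ‖y k - κ.fourier k‖ ^ 2) < ε := hκ
    rw [Real.sqrt_mul (by positivity), one_div, Real.sqrt_inv, inv_mul_lt_iff₀ (by positivity)] at h
    rw [EuclideanSpace.norm_eq]
    exact h.le.trans_eq (mul_comm _ _)
  have h := norm_sub_le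
    (WithLp.toLp 2 fun k => y k - μ.fourier k : EuclideanSpace ℂ (Fin (2 * N + 1)))
    (WithLp.toLp 2 fun k => y k - ν.fourier k)
  have e : √(∑ k : Fin (2 * N + 1), ‖(ν - μ).fourier k‖ ^ 2) =
      ‖(WithLp.toLp 2 fun k => y k - μ.fourier k : EuclideanSpace ℂ (Fin (2 * N + 1))) -
        (WithLp.toLp 2 fun k => y k - ν.fourier k)‖ := by
    rw [EuclideanSpace.norm_eq]
    congr 1
    refine Finset.sum_congr rfl fun k _ => ?_
    simp [SpikeDistribution.fourier_sub]
  rw [e]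
  linarith [key μ hμ, key ν hν]

/-- The map choosing any consistent signal errs by at most the diameter of the set of consistent
signals. -/
theorem minmaxError_le {R : Set SpikeDistribution} {N : ℕ} {ε B : ℝ}
    (h : ∀ μ ∈ R, ∀ ν ∈ R, ∀ y ∈ dataBall N ε μ, y ∈ dataBall N ε ν → (ν - μ).l2norm ≤ B) :
    minmaxError R N ε ≤ ENNReal.ofReal B := by
  classical
  let φ : (Fin (2 * N + 1) → ℂ) → SpikeDistribution := fun y =>
    if hy : ∃ ν ∈ R, y ∈ dataBall N ε ν then hy.choose else 0
  have hφ : ∀ μ ∈ R, ∀ y ∈ dataBall N ε μ, φ y ∈ R ∧ y ∈ dataBall N ε (φ y) := by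
    intro μ hμ y hy
    have hex : ∃ ν ∈ R, y ∈ dataBall N ε ν := ⟨μ, hμ, hy⟩
    simp only [φ, dif_pos hex]
    exact hex.choose_spec
  refine iInf₂_le_of_le φ (fun μ hμ y hy => (hφ μ hμ y hy).1) ?_
  refine iSup₂_le fun μ hμ => iSup₂_le fun y hy => ENNReal.ofReal_le_ofReal ?_
  exact h μ hμ _ (hφ μ hμ y hy).1 y hy (hφ μ hμ y hy).2

theorem minmaxError_upper_bound (s ℓ : ℕ) (hℓ : 2 ≤ ℓ) (hs : ℓ ≤ s) :
    ∃ C : ℝ, 0 < C ∧ ∀ ε ρ τ M : ℝ, 0 < ε → 0 ≤ ρ → (ℓ < s → 0 < ρ) → π ≤ M →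
      ∃ Δ₀ : ℝ, 0 < Δ₀ ∧ ∀ (Δ : ℝ) (N : ℕ), 0 < Δ → Δ ≤ Δ₀ → SRF N Δ = M →
        ∀ R ⊆ clusteredSpikes Δ ρ s ℓ τ, minmaxError R N ε ≤
          ENNReal.ofReal (C * SRF N Δ ^ (4 * ℓ - 1) * ε) := by
  have hs1 : 1 ≤ s := by omega
  have hsr : (1 : ℝ) ≤ s := by exact_mod_cast hs1
  have hpi := Real.pi_pos
  refine ⟨√(4 * s) * (11 * s * 16 ^ s * (2 * √(8 * s))) * (2 * π * s) ^ (4 * ℓ - 1),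
    by positivity, ?_⟩
  intro ε ρ τ M hε hρ hρs hM
  have hM0 : 0 < M := by linarith
  -- Forces N ≥ 2s + 4sπ/ρ, hence Q ≥ 1 and, for ρ > 0, Q ≥ π/ρ, so that far nodes separate by 1. If
  -- ρ = 0, then `π / ρ` is 0 and no pair counts as far.
  refine ⟨1 / (M * (2 * s + 4 * s * (π / ρ))), by positivity, ?_⟩
  intro Δ N hΔ hΔ₀ hSRF R hR
  rw [hSRF]
  have hN0 : N ≠ 0 := by
    rintro rfl
    simp [SRF] at hSRF
    linarith
  have hN1 : 1 ≤ N := Nat.one_le_iff_ne_zero.2 hN0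
  have hNr : (0 : ℝ) < N := by exact_mod_cast hN1
  have hNΔ : N * Δ * M = 1 := by
    rw [← hSRF, SRF]; field_simp
  have hNlarge : 2 * s + 4 * s * (π / ρ) ≤ N := by
    rw [le_div_iff₀ (by positivity)] at hΔ₀
    have : Δ * (M * (2 * s + 4 * s * (π / ρ))) ≤ Δ * (M * N) := by linarith
    exact le_of_mul_le_mul_left (le_of_mul_le_mul_left this hΔ) hM0
  have hN2s : 2 * s ≤ N := by
    have : (0 : ℝ) ≤ 4 * s * (π / ρ) := by positivity
    have : (2 * s : ℝ) ≤ N := by linarith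
    exact_mod_cast this
  set Q := N / (2 * s) with hQ
  have hQ1 : 1 ≤ Q := (Nat.one_le_div_iff (by omega)).2 hN2s
  have hQr : (1 : ℝ) ≤ Q := by exact_mod_cast hQ1
  have hQN : 2 * s * Q ≤ N := Nat.mul_div_le _ _
  have hQlow : (N : ℝ) ≤ 4 * s * Q := by
    have h1 : N < 2 * s * (Q + 1) := Nat.lt_mul_div_succ N (by omega)
    have h2 : N ≤ 4 * s * Q := by nlinarith
    exact_mod_cast h2
  -- From N ≤ 4sQ and NΔM = 1: (2/π)QΔ ≥ 1/(2πsM).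
  set δ := (2 * π * s * M)⁻¹ with hδdef
  have hδ : 0 < δ := by positivity
  have hδ1 : δ ≤ 1 := by
    refine inv_le_one_of_one_le₀ ?_
    have : 3 < π := Real.pi_gt_three
    have h1 : 1 ≤ 2 * π := by linarith
    exact one_le_mul_of_one_le_of_one_le (one_le_mul_of_one_le_of_one_le h1 hsr) (by linarith)
  refine minmaxError_le fun μ hμ ν hν y hyμ hyν => ?_
  obtain ⟨x₁, hg₁, hx₁, hsub₁⟩ := hR hμ
  obtain ⟨x₂, hg₂, hx₂, hsub₂⟩ := hR hν
  classical
  have hsupp : (ν - μ).support ⊆ x₁ ∪ x₂ := by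
    intro t ht
    rcases Finset.mem_union.1 (Finsupp.support_sub ht) with h | h
    · exact Finset.mem_union_right _ (hsub₂ h)
    · exact Finset.mem_union_left _ (hsub₁ h)
  have hgrid : ∀ t ∈ (ν - μ).support, t ∈ grid Δ := fun t ht =>
    (Finset.mem_union.1 (hsupp ht)).elim (hg₁ t) (hg₂ t)
  have hIoc : ∀ t ∈ (ν - μ).support, t ∈ Set.Ioc (-(π / 2)) (π / 2) := fun t ht =>
    (Finset.mem_union.1 (hsupp ht)).elim (hx₁.mem_Ioc t) (hx₂.mem_Ioc t)
  have hcard : (ν - μ).support.card ≤ 2 * s := by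
    refine (Finset.card_le_card hsupp).trans ((Finset.card_union_le _ _).trans ?_)
    rw [hx₁.card_eq, hx₂.card_eq]; omega
  have hmain := SpikeDistribution.l2norm_le_of_separated (ν - μ) (m := 2 * ℓ - 1)
    (fun t u => 0 < ρ ∧ ρ / 2 ≤ |t - u|) hQ1 hs1 hQN hδ hδ1 hcard
    (fun t ht u hu htu => ?_) (fun t ht u hu htu hfar => ?_) (fun t ht => ?_)
  · refine hmain.trans ?_
    have hE := sqrt_sum_le_of_mem_dataBall hN1 hyμ hyν
    have hratio : (√Q)⁻¹ * √(2 * N) ≤ √(8 * s) := by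
      rw [← Real.sqrt_inv, ← Real.sqrt_mul (by positivity)]
      refine Real.sqrt_le_sqrt ?_
      rw [inv_mul_le_iff₀ (by linarith)]
      linarith
    have hexp : δ⁻¹ * (δ⁻¹ ^ (2 * ℓ - 1)) ^ 2 = (2 * π * s) ^ (4 * ℓ - 1) * M ^ (4 * ℓ - 1) := by
      rw [← pow_mul, ← pow_succ', hδdef, inv_inv, ← mul_pow]
      congr 1; omega
    calc _ ≤ √(4 * s) * (11 * s * δ⁻¹ * (16 ^ s * (δ⁻¹ ^ (2 * ℓ - 1)) ^ 2 * (√Q)⁻¹) *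
            (2 * ε * √(2 * N))) := by gcongr
      _ = √(4 * s) * (11 * s * 16 ^ s * (2 * ((√Q)⁻¹ * √(2 * N)))) *
            (δ⁻¹ * (δ⁻¹ ^ (2 * ℓ - 1)) ^ 2) * ε := by ring
      _ ≤ √(4 * s) * (11 * s * 16 ^ s * (2 * √(8 * s))) *
            (δ⁻¹ * (δ⁻¹ ^ (2 * ℓ - 1)) ^ 2) * ε := by gcongr
      _ = _ := by rw [hexp]; ring
  · have hd := le_abs_sub_of_mem_grid hΔ (hgrid t ht) (hgrid u hu) htu
    refine exists_pow_separating (hΔ.trans_le hd) (abs_sub_lt_pi (hIoc t ht) (hIoc u hu)).le hδ1 ?_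
    have h1 : 1 ≤ 4 * s * M * (Q * |t - u|) := by
      calc (1 : ℝ) = N * Δ * M := hNΔ.symm
        _ ≤ (4 * s * Q) * |t - u| * M := by gcongr
        _ = _ := by ring
    rw [hδdef, inv_le_iff_one_le_mul₀ (by positivity)]
    calc (1 : ℝ) ≤ 4 * s * M * (Q * |t - u|) := h1
      _ = _ := by field_simp; ring
  · refine exists_pow_separating (lt_of_lt_of_le (by linarith [hfar.1]) hfar.2)
      (abs_sub_lt_pi (hIoc t ht) (hIoc u hu)).le le_rfl ?_
    have hρ0 := hfar.1
    have h1 : π / ρ ≤ Q := by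
      have : 4 * s * (π / ρ) ≤ 4 * s * Q := by linarith
      exact le_of_mul_le_mul_left this (by positivity)
    rw [div_le_iff₀ hρ0] at h1
    have h2 : π / 2 ≤ Q * |t - u| := by nlinarith [hfar.2]
    calc (1 : ℝ) = 2 / π * (π / 2) := by field_simp
      _ ≤ _ := by gcongr
  · have h1 := hx₁.card_close_le hρs t
    have h2 := hx₂.card_close_le hρs t
    have hfin : ((x₁ ∪ x₂ : Finset ℝ) : Set ℝ).Finite := Finset.finite_toSet _
    -- Counting t itself among the at most 2ℓ close nodes leaves 2ℓ - 1 others; this saves two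
    -- powers of SRF.
    have hsubs : insert t {u ∈ ((ν - μ).support : Set ℝ) | u ≠ t ∧ ¬ (0 < ρ ∧ ρ / 2 ≤ |t - u|)} ⊆
        {u ∈ (x₁ : Set ℝ) | ¬ (0 < ρ ∧ ρ / 2 ≤ |t - u|)} ∪
        {u ∈ (x₂ : Set ℝ) | ¬ (0 < ρ ∧ ρ / 2 ≤ |t - u|)} := by
      have aux : ∀ u ∈ (ν - μ).support, ¬ (0 < ρ ∧ ρ / 2 ≤ |t - u|) →
          u ∈ {u ∈ (x₁ : Set ℝ) | ¬ (0 < ρ ∧ ρ / 2 ≤ |t - u|)} ∪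
            {u ∈ (x₂ : Set ℝ) | ¬ (0 < ρ ∧ ρ / 2 ≤ |t - u|)} := fun u hu hc =>
        (Finset.mem_union.1 (hsupp hu)).imp (fun h => ⟨h, hc⟩) fun h => ⟨h, hc⟩
      refine Set.insert_subset (aux t ht ?_) fun u hu => aux u hu.1 hu.2.2
      rw [sub_self, abs_zero]; rintro ⟨h, h'⟩; linarith
    have hcardle := Set.ncard_le_ncard hsubs
      ((x₁.finite_toSet.subset fun u hu => hu.1).union (x₂.finite_toSet.subset fun u hu => hu.1))
    rw [Set.ncard_insert_of_notMem (fun h => h.2.1 rfl)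
      ((ν - μ).support.finite_toSet.subset fun u hu => hu.1)] at hcardle
    have := Set.ncard_union_le {u ∈ (x₁ : Set ℝ) | ¬ (0 < ρ ∧ ρ / 2 ≤ |t - u|)}
      {u ∈ (x₂ : Set ℝ) | ¬ (0 < ρ ∧ ρ / 2 ≤ |t - u|)}
    omega

/-! ### Functionals with many vanishing moments. -/

/-- Coefficients of a functional `f ↦ ∑ a_j f(j) - b_j f'(j)` at the nodes `0, …, n - 1` that
annihilates the polynomials of degree less than `2 n - 1`. -/
theorem exists_annihilating_coefficients {n : ℕ} (hn : 2 ≤ n) :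
    ∃ a b : Fin n → ℂ, a ≠ 0 ∧ ∀ k < 2 * n - 1,
      ∑ j : Fin n, (a j * (j : ℂ) ^ k - b j * (k * (j : ℂ) ^ (k - 1))) = 0 := by
  let f : (Fin n → ℂ) × (Fin n → ℂ) →ₗ[ℂ] (Fin (2 * n - 1) → ℂ) :=
    { toFun := fun p k =>
        ∑ j : Fin n, (p.1 j * (j : ℂ) ^ (k : ℕ) - p.2 j * ((k : ℕ) * (j : ℂ) ^ ((k : ℕ) - 1)))
      map_add' := fun p q => by
        funext k
        simp only [Prod.fst_add, Prod.snd_add, Pi.add_apply, ← Finset.sum_add_distrib]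
        exact Finset.sum_congr rfl fun j _ => by ring
      map_smul' := fun c p => by
        funext k
        simp only [Prod.smul_fst, Prod.smul_snd, Pi.smul_apply, smul_eq_mul, RingHom.id_apply,
          Finset.mul_sum]
        exact Finset.sum_congr rfl fun j _ => by ring }
  -- 2n unknowns against 2n - 1 equations.
  have hker : LinearMap.ker f ≠ ⊥ := by
    apply LinearMap.ker_ne_bot_of_finrank_lt
    rw [Module.finrank_prod]
    simp only [Module.finrank_fin_fun]
    omega
  obtain ⟨⟨a, b⟩, hab, hne⟩ := (Submodule.ne_bot_iff _).1 hker
  have hf : ∀ k < 2 * n - 1,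
      ∑ j : Fin n, (a j * (j : ℂ) ^ k - b j * (k * (j : ℂ) ^ (k - 1))) = 0 := fun k hk =>
    congrFun (LinearMap.mem_ker.1 hab) ⟨k, hk⟩
  refine ⟨a, b, ?_, hf⟩
  rintro rfl
  apply hne
  -- With a = 0 the moments k = 1, …, n form a Vandermonde system for b; they are available because
  -- n ≤ 2n - 2.
  have hb : b = 0 := by
    refine Matrix.eq_zero_of_forall_pow_sum_mul_pow_eq_zero (f := fun j : Fin n => (j : ℂ))
      (fun i j hij => Fin.ext (Nat.cast_injective (R := ℂ) hij)) fun i => ?_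
    have h := hf (i + 1) (by have := i.2; omega)
    simp only [Pi.zero_apply, zero_mul, zero_sub, Finset.sum_neg_distrib, neg_eq_zero,
      Nat.add_sub_cancel] at h
    have hi : ((i : ℕ) + 1 : ℂ) ≠ 0 := by exact_mod_cast (i : ℕ).succ_ne_zero
    refine (mul_eq_zero.1 (?_ : ((i : ℕ) + 1 : ℂ) * _ = 0)).resolve_left hi
    rw [← h, Finset.mul_sum]
    exact Finset.sum_congr rfl fun j _ => by push_cast; ring
  rw [hb]; rfl

/-- A functional annihilating low degree polynomials is small on slow exponentials. -/
theorem exists_bound_of_annihilating {n m : ℕ} (hn : 1 ≤ n) (a b : Fin n → ℂ)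
    (h : ∀ k < m + 1, ∑ j : Fin n, (a j * (j : ℂ) ^ k - b j * (k * (j : ℂ) ^ (k - 1))) = 0) :
    ∃ K : ℝ, 0 < K ∧ ∀ ω : ℝ, 0 ≤ ω → ω ≤ 1 →
      ‖∑ j : Fin n, (a j + b j * (Complex.I * ω)) * Complex.exp (-(Complex.I * ω * j))‖ ≤
        K * ω ^ (m + 1) := by
  have hnr : (1 : ℝ) ≤ n := by exact_mod_cast hn
  refine ⟨∑ j : Fin n, (‖a j‖ + ‖b j‖) * ((n : ℝ) ^ (m + 1) * Real.exp n) + 1,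
    by positivity, fun ω h0 h1 => ?_⟩
  let x : Fin n → ℂ := fun j => -(Complex.I * ω * j)
  let T : ℕ → Fin n → ℂ := fun r j => ∑ k ∈ Finset.range r, x j ^ k / (k.factorial : ℂ)
  have hx : ∀ j, ‖x j‖ ≤ ω * n := fun j => by
    simp only [x, norm_neg, norm_mul, Complex.norm_I, one_mul, Complex.norm_real,
      Complex.norm_natCast, Real.norm_eq_abs, abs_of_nonneg h0]
    gcongr
    exact j.2.le
  have hT : ∀ r ≤ m + 1, ∀ j, ‖Complex.exp (x j) - T r j‖ ≤
      ω ^ r * ((n : ℝ) ^ (m + 1) * Real.exp n) := fun r hr j => by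
    refine (Complex.norm_exp_sub_sum_le_norm_mul_exp (x j) r).trans ?_
    calc ‖x j‖ ^ r * Real.exp ‖x j‖ ≤ (ω * n) ^ r * Real.exp n := by
          gcongr
          · exact hx j
          · refine (hx j).trans ?_
            nlinarith
      _ = ω ^ r * (n ^ r * Real.exp n) := by ring
      _ ≤ _ := by gcongr
  -- This is the functional applied to the Taylor polynomial of degree m of e^{-iωx}.
  -- Differentiation lowers the degree by one but gives a factor ω, so both remainders are of order
  -- ω^(m+1).
  have hmain : ∑ j : Fin n, (a j * T (m + 1) j + b j * (Complex.I * ω) * T m j) = 0 := by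
    have : ∀ j : Fin n, a j * T (m + 1) j + b j * (Complex.I * ω) * T m j =
        ∑ k ∈ Finset.range (m + 1), (-(Complex.I * ω)) ^ k / (k.factorial : ℂ) *
          (a j * (j : ℂ) ^ k - b j * (k * (j : ℂ) ^ (k - 1))) := fun j => by
      simp only [mul_sub, Finset.sum_sub_distrib]
      rw [sub_eq_add_neg]
      congr 1
      · simp only [T, x, Finset.mul_sum]
        refine Finset.sum_congr rfl fun k _ => ?_
        rw [← neg_mul, mul_pow]; ring
      · rw [Finset.sum_range_succ']
        simp only [T, x, Finset.mul_sum, Nat.cast_zero, zero_mul, mul_zero, add_zero,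
          Nat.add_sub_cancel, ← Finset.sum_neg_distrib]
        refine Finset.sum_congr rfl fun k _ => ?_
        rw [← neg_mul, mul_pow, pow_succ, Nat.factorial_succ]
        have h1 : (k.factorial : ℂ) ≠ 0 := by exact_mod_cast k.factorial_ne_zero
        have h2 : ((k + 1 : ℕ) : ℂ) ≠ 0 := by exact_mod_cast k.succ_ne_zero
        rw [Nat.cast_mul]
        field_simp
    simp only [this]
    rw [Finset.sum_comm]
    refine Finset.sum_eq_zero fun k hk => ?_
    rw [← Finset.mul_sum, h k (Finset.mem_range.1 hk), mul_zero]
  have hsplit : ∑ j : Fin n, (a j + b j * (Complex.I * ω)) * Complex.exp (-(Complex.I * ω * j)) =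
      ∑ j : Fin n, (a j * (Complex.exp (x j) - T (m + 1) j) +
        b j * (Complex.I * ω) * (Complex.exp (x j) - T m j)) := by
    rw [← sub_zero (∑ j : Fin n, (_ * _)), ← hmain, ← Finset.sum_sub_distrib]
    refine Finset.sum_congr rfl fun j _ => ?_
    simp only [x]; ring
  rw [hsplit, add_mul, Finset.sum_mul]
  refine (norm_sum_le_of_le (n := fun j => (‖a j‖ + ‖b j‖) * ((n : ℝ) ^ (m + 1) * Real.exp n) *
    ω ^ (m + 1)) _ fun j _ => ?_).trans (le_add_of_nonneg_right (by positivity))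
  refine (norm_add_le _ _).trans ?_
  simp only [norm_mul, Complex.norm_I, one_mul, Complex.norm_real, Real.norm_eq_abs,
    abs_of_nonneg h0]
  calc _ ≤ ‖a j‖ * (ω ^ (m + 1) * ((n : ℝ) ^ (m + 1) * Real.exp n)) +
        ‖b j‖ * ω * (ω ^ m * ((n : ℝ) ^ (m + 1) * Real.exp n)) := by
        gcongr
        · exact hT _ le_rfl j
        · exact hT _ (Nat.le_succ _) j
    _ = _ := by ring

/-! ### Block configurations on the grid. -/

/-- The `j`-th index of a configuration made of blocks of `ℓ` consecutive integers, the blocks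
starting at `b`, `b + p`, `b + 2 p`, …. -/
def blockIndex (ℓ : ℕ) (p b : ℤ) (j : ℕ) : ℤ := b + (j / ℓ : ℕ) * p + (j % ℓ : ℕ)

theorem blockIndex_of_lt {ℓ j : ℕ} (p b : ℤ) (h : j < ℓ) : blockIndex ℓ p b j = b + j := by
  simp [blockIndex, Nat.div_eq_of_lt h, Nat.mod_eq_of_lt h]

theorem blockIndex_sub_of_div_eq {ℓ i j : ℕ} (p b : ℤ) (h : i / ℓ = j / ℓ) :
    blockIndex ℓ p b i - blockIndex ℓ p b j = (i : ℤ) - j := by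
  have hi := Nat.div_add_mod i ℓ
  have hj := Nat.div_add_mod j ℓ
  rw [h] at hi
  simp only [blockIndex, h]
  omega

theorem abs_sub_lt_of_div_eq {ℓ i j : ℕ} (hℓ : 0 < ℓ) (h : i / ℓ = j / ℓ) :
    |(i : ℤ) - j| ≤ ℓ - 1 := by
  have hi := Nat.div_add_mod i ℓ
  have hj := Nat.div_add_mod j ℓ
  have hi' := Nat.mod_lt i hℓ
  have hj' := Nat.mod_lt j hℓ
  rw [h] at hi
  rw [abs_le]
  omega

theorem le_abs_blockIndex_sub {ℓ i j : ℕ} {p : ℤ} (b : ℤ) (hℓ : 0 < ℓ) (hp : (ℓ : ℤ) ≤ p)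
    (h : i / ℓ ≠ j / ℓ) : p - (ℓ - 1) ≤ |blockIndex ℓ p b i - blockIndex ℓ p b j| := by
  wlog hlt : i / ℓ < j / ℓ generalizing i j
  · rw [abs_sub_comm]
    exact this h.symm (by omega)
  have hi' := Nat.mod_lt i hℓ
  have hj' := Nat.mod_lt j hℓ
  have h1 : ((i / ℓ : ℕ) : ℤ) + 1 ≤ (j / ℓ : ℕ) := by exact_mod_cast hlt
  have h2 : (((i / ℓ : ℕ) : ℤ) + 1) * p ≤ (j / ℓ : ℕ) * p := by gcongr; omega
  rw [abs_sub_comm]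
  refine le_trans ?_ (le_abs_self _)
  simp only [blockIndex]
  have : ((i % ℓ : ℕ) : ℤ) ≤ ℓ - 1 := by omega
  linarith [Int.natCast_nonneg (j % ℓ)]

theorem blockIndex_injective {ℓ : ℕ} {p : ℤ} (b : ℤ) (hℓ : 0 < ℓ) (hp : (ℓ : ℤ) ≤ p) :
    Function.Injective (blockIndex ℓ p b) := by
  intro i j hij
  by_cases h : i / ℓ = j / ℓ
  · have := blockIndex_sub_of_div_eq p b h
    omega
  · have := le_abs_blockIndex_sub b hℓ hp h
    rw [hij, sub_self, abs_zero] at this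
    omega

/-- The grid nodes of the first `s` block indices. -/
noncomputable def blockNodes (Δ : ℝ) (s ℓ : ℕ) (p b : ℤ) : Finset ℝ :=
  (Finset.range s).image fun j => (blockIndex ℓ p b j : ℝ) * Δ

theorem isClustered_blockNodes {Δ ρ τ : ℝ} {s ℓ : ℕ} {p b : ℤ} (hΔ : 0 < Δ) (hℓ : 2 ≤ ℓ)
    (hs : ℓ ≤ s) (hτ : (ℓ : ℝ) - 1 ≤ τ) (hτ' : τ ≤ π / Δ) (hρ : 0 ≤ ρ) (hp : (ℓ : ℤ) ≤ p)
    (hpρ : ρ ≤ (p - (ℓ - 1)) * Δ)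
    (hIoc : ∀ j < s, (blockIndex ℓ p b j : ℝ) * Δ ∈ Set.Ioc (-(π / 2)) (π / 2)) :
    IsClustered Δ ρ s ℓ τ (blockNodes Δ s ℓ p b) := by
  have hℓ0 : 0 < ℓ := by omega
  have hinj : Function.Injective fun j => (blockIndex ℓ p b j : ℝ) * Δ := fun i j hij =>
    blockIndex_injective b hℓ0 hp (by exact_mod_cast mul_right_cancel₀ hΔ.ne' hij)
  have hdist : ∀ i < s, ∀ j < s,
      wrapDist ((blockIndex ℓ p b i : ℝ) * Δ - (blockIndex ℓ p b j : ℝ) * Δ) =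
        ((|blockIndex ℓ p b i - blockIndex ℓ p b j| : ℤ) : ℝ) * Δ := fun i hi j hj => by
    rw [wrapDist_eq_abs (abs_sub_lt_pi (hIoc i hi) (hIoc j hj)), ← sub_mul, abs_mul,
      abs_of_pos hΔ]
    push_cast; rfl
  refine ⟨hΔ, hℓ, hs, hτ, hτ', hρ, ?_, ?_, ?_⟩
  · rw [blockNodes, Finset.card_image_of_injective _ hinj, Finset.card_range]
  · intro u hu
    obtain ⟨j, hj, rfl⟩ := Finset.mem_image.1 hu
    exact hIoc j (Finset.mem_range.1 hj)
  · intro u hu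
    obtain ⟨j, hj, rfl⟩ := Finset.mem_image.1 hu
    have hjs := Finset.mem_range.1 hj
    refine ⟨((Finset.range s).filter fun i => i / ℓ = j / ℓ).image
      fun j => (blockIndex ℓ p b j : ℝ) * Δ, Finset.image_subset_image (Finset.filter_subset _ _),
      Finset.mem_image_of_mem _ (Finset.mem_filter.2 ⟨hj, rfl⟩), ?_, ?_, ?_⟩
    · refine Finset.card_image_le.trans ?_
      have hsub : ((Finset.range s).filter fun i => i / ℓ = j / ℓ) ⊆
          Finset.Ico (j / ℓ * ℓ) (j / ℓ * ℓ + ℓ) := by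
        intro i hi
        have hi := (Finset.mem_filter.1 hi).2
        have h1 := Nat.div_add_mod' i ℓ
        have h2 := Nat.mod_lt i hℓ0
        rw [hi] at h1
        rw [Finset.mem_Ico]
        omega
      simpa using Finset.card_le_card hsub
    · intro y hy hne
      obtain ⟨i, hi, rfl⟩ := Finset.mem_image.1 hy
      obtain ⟨hi, hij⟩ := Finset.mem_filter.1 hi
      rw [hdist i (Finset.mem_range.1 hi) j hjs, blockIndex_sub_of_div_eq p b hij]
      have h1 : 1 ≤ |(i : ℤ) - j| := by
        refine Int.one_le_abs (sub_ne_zero.2 fun h => hne ?_)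
        rw [Int.natCast_inj.1 h]
      have h2 := abs_sub_lt_of_div_eq hℓ0 hij
      have h1' : (1 : ℝ) ≤ ((|(i : ℤ) - j| : ℤ) : ℝ) := by exact_mod_cast h1
      have h2' : ((|(i : ℤ) - j| : ℤ) : ℝ) ≤ ℓ - 1 := by exact_mod_cast h2
      exact ⟨le_mul_of_one_le_left hΔ.le h1', by gcongr; exact h2'.trans hτ⟩
    · intro y hy hyc
      obtain ⟨i, hi, rfl⟩ := Finset.mem_image.1 hy
      rw [hdist i (Finset.mem_range.1 hi) j hjs]
      have hij : i / ℓ ≠ j / ℓ := fun h =>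
        hyc (Finset.mem_image_of_mem _ (Finset.mem_filter.2 ⟨hi, h⟩))
      have h1 := le_abs_blockIndex_sub b hℓ0 hp hij
      refine hpρ.trans ?_
      gcongr
      exact_mod_cast h1

/-- Two clustered configurations on the grid whose first clusters are adjacent. -/
theorem exists_adjacent_configurations {Δ ρ τ : ℝ} {s ℓ : ℕ} (hΔ : 0 < Δ) (hℓ : 2 ≤ ℓ)
    (hs : ℓ ≤ s) (hτ : (ℓ : ℝ) - 1 ≤ τ) (hτ' : τ ≤ π / Δ) (hρ : 0 ≤ ρ)
    (hroom : ((⌈(s : ℝ) / (ℓ : ℝ)⌉₊ : ℝ) - 1) * (ρ + ℓ * Δ) + 2 * (ℓ + 1) * Δ ≤ π) :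
    ∃ (b : ℤ) (x₁ x₂ : Finset ℝ), (∀ u ∈ x₁, u ∈ grid Δ) ∧ (∀ u ∈ x₂, u ∈ grid Δ) ∧
      IsClustered Δ ρ s ℓ τ x₁ ∧ IsClustered Δ ρ s ℓ τ x₂ ∧
      (∀ j < ℓ, ((b : ℝ) + j) * Δ ∈ x₁) ∧ ∀ j < ℓ, ((b : ℝ) + (ℓ + j : ℕ)) * Δ ∈ x₂ := by
  have hℓ0 : 0 < ℓ := by omega
  set M := ⌊π / (2 * Δ)⌋ with hM
  -- The gap from the end of a block to the next is p - (ℓ - 1) steps: at least one, and at least ρ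
  -- in length.
  set p : ℤ := ℓ - 1 + max 1 ⌈ρ / Δ⌉ with hp
  set c := ⌈(s : ℝ) / (ℓ : ℝ)⌉₊ with hc
  have hpℓ : (ℓ : ℤ) ≤ p := by have := le_max_left 1 ⌈ρ / Δ⌉; omega
  have hpρ : ρ ≤ (p - (ℓ - 1)) * Δ := by
    have h1 : ρ / Δ ≤ (max 1 ⌈ρ / Δ⌉ : ℤ) :=
      (Int.le_ceil _).trans (by exact_mod_cast le_max_right _ _)
    rw [div_le_iff₀ hΔ] at h1
    rw [hp]
    push_cast at h1 ⊢
    linarith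
  have hpΔ : p * Δ ≤ ρ + ℓ * Δ := by
    have h1 : ((max 1 ⌈ρ / Δ⌉ : ℤ) : ℝ) ≤ ρ / Δ + 1 := by
      push_cast
      refine max_le ?_ (Int.ceil_lt_add_one _).le
      have : 0 ≤ ρ / Δ := by positivity
      linarith
    have h2 : ((max 1 ⌈ρ / Δ⌉ : ℤ) : ℝ) * Δ ≤ (ρ / Δ + 1) * Δ := by gcongr
    rw [add_mul, div_mul_cancel₀ _ hΔ.ne'] at h2
    rw [hp]
    push_cast at h2 ⊢
    linarith
  have hdiv : ∀ j < s, j / ℓ + 1 ≤ c := fun j hj => by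
    rw [Nat.succ_le_iff, hc, Nat.lt_ceil, lt_div_iff₀ (by exact_mod_cast hℓ0)]
    have := Nat.div_mul_le_self j ℓ
    exact_mod_cast this.trans_lt hj
  have hwidth : ∀ j < s, ((j / ℓ : ℕ) : ℤ) * p + 2 * ℓ + 2 ≤ 2 * M + 1 := fun j hj => by
    have h1 : ((j / ℓ : ℕ) : ℝ) ≤ c - 1 := by
      have := hdiv j hj
      have : ((j / ℓ : ℕ) : ℝ) + 1 ≤ c := by exact_mod_cast this
      linarith
    have h2 : (((j / ℓ : ℕ) : ℝ) * p + 2 * ℓ + 2) * Δ ≤ π := by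
      have h0 : 0 ≤ ρ + ℓ * Δ := by positivity
      calc _ = ((j / ℓ : ℕ) : ℝ) * (p * Δ) + 2 * (ℓ + 1) * Δ := by ring
        _ ≤ ((j / ℓ : ℕ) : ℝ) * (ρ + ℓ * Δ) + 2 * (ℓ + 1) * Δ := by gcongr
        _ ≤ (c - 1) * (ρ + ℓ * Δ) + 2 * (ℓ + 1) * Δ := by gcongr
        _ ≤ π := hroom
    have h3 := Int.lt_floor_add_one (π / (2 * Δ))
    rw [← hM, div_lt_iff₀ (by positivity)] at h3
    have h4 : (((j / ℓ : ℕ) : ℝ) * p + 2 * ℓ + 2) * Δ < (2 * M + 2) * Δ := by linarith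
    have h5 := lt_of_mul_lt_mul_right h4 hΔ.le
    have h6 : ((j / ℓ : ℕ) : ℤ) * p + 2 * ℓ + 2 < 2 * M + 2 := by
      generalize j / ℓ = d at h5 ⊢
      rw [← Int.cast_lt (R := ℝ)]
      push_cast
      exact h5
    omega
  have hrange : ∀ b : ℤ, -M + 1 ≤ b → b ≤ -M + 1 + ℓ → ∀ j < s,
      -M + 1 ≤ blockIndex ℓ p b j ∧ blockIndex ℓ p b j ≤ M := fun b hb hb' j hj => by
    have h1 := hwidth j hj
    have h2 := Nat.mod_lt j hℓ0
    have h3 : 0 ≤ ((j / ℓ : ℕ) : ℤ) * p :=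
      mul_nonneg (Int.natCast_nonneg _) (by omega)
    simp only [blockIndex]
    constructor <;> omega
  have hMΔ : M * Δ ≤ π / 2 := by
    have := Int.floor_le (π / (2 * Δ))
    rw [← hM, le_div_iff₀ (by positivity)] at this
    linarith
  have hgrid : ∀ b : ℤ, -M + 1 ≤ b → b ≤ -M + 1 + ℓ → ∀ u ∈ blockNodes Δ s ℓ p b, u ∈ grid Δ :=
    fun b hb hb' u hu => by
      obtain ⟨j, hj, rfl⟩ := Finset.mem_image.1 hu
      obtain ⟨h1, h2⟩ := hrange b hb hb' j (Finset.mem_range.1 hj)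
      exact ⟨blockIndex ℓ p b j, by omega, h2, rfl⟩
  have hclust : ∀ b : ℤ, -M + 1 ≤ b → b ≤ -M + 1 + ℓ →
      IsClustered Δ ρ s ℓ τ (blockNodes Δ s ℓ p b) := fun b hb hb' =>
    isClustered_blockNodes hΔ hℓ hs hτ hτ' hρ hpℓ hpρ fun j hj => by
      obtain ⟨h1, h2⟩ := hrange b hb hb' j hj
      have h1' : (-M + 1 : ℝ) ≤ blockIndex ℓ p b j := by exact_mod_cast h1
      have h2' : (blockIndex ℓ p b j : ℝ) ≤ M := by exact_mod_cast h2
      exact ⟨by nlinarith, by nlinarith⟩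
  -- Starting at -M + 1 avoids -MΔ, which may equal the excluded endpoint -π/2. The shift by ℓ makes
  -- the two first blocks adjacent.
  refine ⟨-M + 1, blockNodes Δ s ℓ p (-M + 1), blockNodes Δ s ℓ p (-M + 1 + ℓ),
    hgrid _ le_rfl (by omega), hgrid _ (by omega) le_rfl,
    hclust _ le_rfl (by omega), hclust _ (by omega) le_rfl, fun j hj => ?_, fun j hj => ?_⟩
  · refine Finset.mem_image.2 ⟨j, Finset.mem_range.2 (by omega), ?_⟩
    simp only [blockIndex_of_lt p _ hj]; push_cast; rfl
  · refine Finset.mem_image.2 ⟨j, Finset.mem_range.2 (by omega), ?_⟩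
    simp only [blockIndex_of_lt p _ hj]; push_cast; ring

/-! ### The lower bound. -/

theorem le_minmaxError {R : Set SpikeDistribution} {N : ℕ} {ε : ℝ} {μ ν : SpikeDistribution}
    (hμ : μ ∈ R) (hν : ν ∈ R) {y : Fin (2 * N + 1) → ℂ} (hyμ : y ∈ dataBall N ε μ)
    (hyν : y ∈ dataBall N ε ν) (t : ℝ) :
    ENNReal.ofReal (‖((μ - ν) t).1‖ / 2) ≤ minmaxError R N ε := by
  refine le_iInf₂ fun φ _ => ?_
  have htri : ‖((μ - ν) t).1‖ ≤ (φ y - μ).l2norm + (φ y - ν).l2norm := by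
    have h : ((μ - ν) t).1 = ((φ y - ν) t).1 - ((φ y - μ) t).1 := by
      simp only [Finsupp.sub_apply, Prod.fst_sub]; ring
    rw [h]
    refine (norm_sub_le _ _).trans ?_
    linarith [(φ y - μ).norm_fst_le_l2norm t, (φ y - ν).norm_fst_le_l2norm t]
  have hsup : ∀ κ ∈ R, y ∈ dataBall N ε κ → ENNReal.ofReal (φ y - κ).l2norm ≤
      ⨆ μ ∈ R, ⨆ y ∈ dataBall N ε μ, ENNReal.ofReal (φ y - μ).l2norm := fun κ hκ hy =>
    le_iSup₂_of_le κ hκ (le_iSup₂_of_le y hy le_rfl)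
  rcases le_total (φ y - μ).l2norm (φ y - ν).l2norm with h | h
  · exact (ENNReal.ofReal_le_ofReal (by linarith)).trans (hsup ν hν hyν)
  · exact (ENNReal.ofReal_le_ofReal (by linarith)).trans (hsup μ hμ hyμ)

/-- The margin ε/2 absorbs the mismatch between 2N + 1 terms and the weight 1/(2N), a ratio of at
most 3/2. -/
theorem mem_dataBall_fourier {N : ℕ} (hN : 1 ≤ N) {ε : ℝ} (hε : 0 < ε) {μ ν : SpikeDistribution}
    (h : ∀ k : Fin (2 * N + 1), ‖(μ - ν).fourier k‖ ≤ ε / 2) :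
    (fun k : Fin (2 * N + 1) => μ.fourier k) ∈ dataBall N ε ν := by
  have hNr : (1 : ℝ) ≤ N := by exact_mod_cast hN
  change √(1 / (2 * (N : ℝ)) * ∑ k : Fin (2 * N + 1), ‖μ.fourier k - ν.fourier k‖ ^ 2) < ε
  rw [Real.sqrt_lt' hε]
  have hsum : ∑ k : Fin (2 * N + 1), ‖μ.fourier k - ν.fourier k‖ ^ 2 ≤
      (2 * N + 1) * (ε / 2) ^ 2 := by
    refine (Finset.sum_le_card_nsmul _ _ ((ε / 2) ^ 2) fun k _ => ?_).trans (by simp)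
    rw [← SpikeDistribution.fourier_sub]
    exact pow_le_pow_left₀ (norm_nonneg _) (h k) 2
  rw [one_div, inv_mul_lt_iff₀ (by positivity)]
  nlinarith [sq_pos_of_pos hε]

theorem minmaxError_lower_bound (ℓ : ℕ) (hℓ : 2 ≤ ℓ) :
    ∃ C : ℝ, 0 < C ∧ ∀ (s N : ℕ) (ε ρ τ Δ : ℝ), (ℓ : ℝ) - 1 ≤ τ → ℓ ≤ s → 1 ≤ N → 0 < ε → 0 ≤ ρ →
      0 < Δ → τ ≤ π / Δ →
      ((⌈(s : ℝ) / (ℓ : ℝ)⌉₊ : ℝ) - 1) * (ρ + ℓ * Δ) + 2 * (ℓ + 1) * Δ ≤ π → N * Δ ≤ 1 / 2 →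
      ENNReal.ofReal (C * SRF N Δ ^ (4 * ℓ - 1) * ε) ≤
        minmaxError (clusteredSpikes Δ ρ s ℓ τ) N ε := by
  obtain ⟨a, b, ha, hab⟩ := exists_annihilating_coefficients (n := 2 * ℓ) (by omega)
  obtain ⟨j₀, hj₀⟩ := Function.ne_iff.1 ha
  have hj₀' : 0 < ‖a j₀‖ := norm_pos_iff.2 hj₀
  obtain ⟨K, hK, hbound⟩ := exists_bound_of_annihilating (m := 4 * ℓ - 2) (by omega) a b
    fun k hk => hab k (by omega)
  rw [show 4 * ℓ - 2 + 1 = 4 * ℓ - 1 by omega] at hbound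
  set m := 4 * ℓ - 1
  refine ⟨‖a j₀‖ / (4 * K * 2 ^ m), by positivity, ?_⟩
  intro s N ε ρ τ Δ hτ hs hN hε hρ hΔ hτ' hroom hNΔ
  obtain ⟨i, x₁, x₂, hg₁, hg₂, hx₁, hx₂, hmem₁, hmem₂⟩ :=
    exists_adjacent_configurations hΔ hℓ hs hτ hτ' hρ hroom
  have hNr : (1 : ℝ) ≤ N := by exact_mod_cast hN
  have hSRF : 0 < SRF N Δ := by unfold SRF; positivity
  -- Solves cK(2NΔ)^m = ε/2, where 2NΔ ≤ 1 bounds every frequency kΔ.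
  set c : ℝ := ε * SRF N Δ ^ m / (2 * K * 2 ^ m) with hc
  have hc0 : 0 < c := by positivity
  let x : Fin (2 * ℓ) → ℝ := fun j => ((i : ℝ) + (j : ℕ)) * Δ
  -- Rescaling integer nodes to step Δ multiplies the δ' amplitudes by Δ. The δ amplitudes keep full
  -- size, which is why a ≠ 0 is needed.
  let term : Fin (2 * ℓ) → SpikeDistribution := fun j =>
    Finsupp.single (x j) ((c : ℂ) * a j, (c : ℂ) * (Δ * b j))
  let μ : SpikeDistribution := ∑ j ∈ Finset.univ.filter (fun j : Fin (2 * ℓ) => (j : ℕ) < ℓ), term j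
  let ν : SpikeDistribution :=
    -∑ j ∈ Finset.univ.filter (fun j : Fin (2 * ℓ) => ¬ (j : ℕ) < ℓ), term j
  have hsub : μ - ν = ∑ j, term j := by
    simp only [μ, ν, sub_neg_eq_add]
    exact Finset.sum_filter_add_sum_filter_not _ _ _
  have hsupp : ∀ (J : Finset (Fin (2 * ℓ))) (y : Finset ℝ), (∀ j ∈ J, x j ∈ y) →
      (∑ j ∈ J, term j : SpikeDistribution).support ⊆ y := by
    classical
    intro J y hJ t ht
    obtain ⟨j, hj, hjt⟩ := Finset.mem_biUnion.1 (Finsupp.support_finsetSum ht)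
    rw [Finset.mem_singleton.1 (Finsupp.support_single_subset hjt)]
    exact hJ j hj
  have hμ : μ ∈ clusteredSpikes Δ ρ s ℓ τ := by
    refine ⟨x₁, hg₁, hx₁, hsupp _ _ fun j hj => hmem₁ j (Finset.mem_filter.1 hj).2⟩
  have hν : ν ∈ clusteredSpikes Δ ρ s ℓ τ := by
    refine ⟨x₂, hg₂, hx₂, ?_⟩
    simp only [ν, Finsupp.support_neg]
    refine hsupp _ _ fun j hj => ?_
    have hj' : ℓ ≤ (j : ℕ) := not_lt.1 (Finset.mem_filter.1 hj).2
    have := hmem₂ (j - ℓ) (by have := j.2; omega)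
    rwa [Nat.add_sub_cancel' hj'] at this
  have hfourier : ∀ k : ℕ, (μ - ν).fourier k = c * unitNode (i * Δ) ^ k *
      ∑ j : Fin (2 * ℓ), (a j + b j * (Complex.I * ((k * Δ : ℝ) : ℂ))) *
        Complex.exp (-(Complex.I * ((k * Δ : ℝ) : ℂ) * j)) := by
    intro k
    rw [hsub, SpikeDistribution.fourier_finset_sum, Finset.mul_sum]
    refine Finset.sum_congr rfl fun j _ => ?_
    rw [SpikeDistribution.fourier_single]
    have h : unitNode (x j) ^ k = unitNode (i * Δ) ^ k *
        Complex.exp (-(Complex.I * ((k * Δ : ℝ) : ℂ) * j)) := by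
      simp only [unitNode, ← Complex.exp_nat_mul, ← Complex.exp_add, x]
      congr 1
      push_cast
      ring
    rw [h]
    push_cast
    ring
  have hsmall : ∀ k : Fin (2 * N + 1), ‖(μ - ν).fourier k‖ ≤ ε / 2 := by
    intro k
    have hk : ((k : ℕ) : ℝ) ≤ 2 * N := by exact_mod_cast Nat.lt_succ_iff.1 k.2
    have hkΔ : ((k : ℕ) : ℝ) * Δ ≤ 2 * N * Δ := by gcongr
    have h := hbound ((k : ℕ) * Δ) (by positivity) (by linarith)
    rw [hfourier, norm_mul, norm_mul, norm_pow, norm_unitNode, one_pow, mul_one,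
      Complex.norm_real, Real.norm_eq_abs, abs_of_pos hc0]
    calc _ ≤ c * (K * (((k : ℕ) : ℝ) * Δ) ^ m) := by gcongr
      _ ≤ c * (K * (2 * N * Δ) ^ m) := by gcongr
      _ = ε / 2 := by
        have : SRF N Δ ^ m * (N * Δ) ^ m = 1 := by
          rw [← mul_pow, SRF, one_div, inv_mul_cancel₀ (by positivity), one_pow]
        rw [hc, mul_assoc 2, mul_pow]
        calc _ = ε / 2 * (SRF N Δ ^ m * (N * Δ) ^ m) * (K / K) * (2 ^ m / 2 ^ m) := by ring
          _ = _ := by rw [this, div_self hK.ne', div_self (by positivity)]; ring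
  have hxinj : Function.Injective x := fun j j' hjj => by
    have := mul_right_cancel₀ hΔ.ne' hjj
    exact Fin.ext (by exact_mod_cast add_left_cancel this)
  have hval : ‖((μ - ν) (x j₀)).1‖ = c * ‖a j₀‖ := by
    have : (μ - ν) (x j₀) = ((c : ℂ) * a j₀, (c : ℂ) * (Δ * b j₀)) := by
      rw [hsub, Finsupp.finsetSum_apply, Finset.sum_eq_single j₀]
      · simp [term]
      · intro j _ hj
        exact Finsupp.single_eq_of_ne (hxinj.ne hj.symm)
      · simp
    rw [this, norm_mul, Complex.norm_real, Real.norm_eq_abs, abs_of_pos hc0]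
  have hself : (fun k : Fin (2 * N + 1) => μ.fourier k) ∈ dataBall N ε μ :=
    mem_dataBall_fourier hN hε fun k => by
      rw [sub_self]
      simpa [SpikeDistribution.fourier, SpikeDistribution.pairing] using by positivity
  refine le_trans (le_of_eq ?_)
    (le_minmaxError hμ hν hself (mem_dataBall_fourier hN hε hsmall) (x j₀))
  rw [hval, hc]
  congr 1
  field_simp
  norm_num

end

theorem theorem3p3 :
    -- upper bound; the constant depends on `s` and `ℓ` only
    (∀ s ℓ : ℕ, 2 ≤ ℓ → ℓ ≤ s → ∃ C : ℝ, 0 < C ∧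
      ∀ ε ρ τ M : ℝ, 0 < ε → 0 ≤ ρ → (ℓ < s → 0 < ρ) → (ℓ : ℝ) - 1 ≤ τ → π ≤ M →
        ∃ β : ℝ, M ≤ β ∧ ∃ Δ₀ : ℝ, 0 < Δ₀ ∧
          ∀ (Δ : ℝ) (N : ℕ), 0 < Δ → Δ ≤ Δ₀ → SRF N Δ = β →
            minmaxError (localizedSpikes Δ ρ s ℓ τ) N ε ≤
              ENNReal.ofReal (C * SRF N Δ ^ (4 * ℓ - 1) * ε)) ∧
    -- lower bound; the constant depends on `ℓ` and `τ` only
    (∀ (ℓ : ℕ) (τ : ℝ), 2 ≤ ℓ → (ℓ : ℝ) - 1 ≤ τ → ∃ C : ℝ, 0 < C ∧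
      ∀ (s N : ℕ) (ε ρ Δ : ℝ), ℓ ≤ s → 1 ≤ N → 0 < ε → 0 ≤ ρ → 0 < Δ → τ ≤ π / Δ →
        ((⌈(s : ℝ) / (ℓ : ℝ)⌉₊ : ℝ) - 1) * (ρ + ℓ * Δ) + 2 * (ℓ + 1) * Δ ≤ π →
        N * Δ ≤ 1 / 2 →
          ENNReal.ofReal (C * SRF N Δ ^ (4 * ℓ - 1) * ε) ≤
            minmaxError (clusteredSpikes Δ ρ s ℓ τ) N ε) := by
  refine ⟨fun s ℓ hℓ hs => ?_, fun ℓ τ hℓ hτ => ?_⟩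
  · obtain ⟨C, hC, h⟩ := minmaxError_upper_bound s ℓ hℓ hs
    -- The estimate holds at the prescribed factor itself, so β = M.
    refine ⟨C, hC, fun ε ρ τ M hε hρ hρs _ hM => ⟨M, le_rfl, ?_⟩⟩
    obtain ⟨Δ₀, hΔ₀, h⟩ := h ε ρ τ M hε hρ hρs hM
    exact ⟨Δ₀, hΔ₀, fun Δ N hΔ hle hSRF => h Δ N hΔ hle hSRF _ fun μ hμ => hμ.1⟩
  · obtain ⟨C, hC, h⟩ := minmaxError_lower_bound ℓ hℓ
    exact ⟨C, hC, fun s N ε ρ Δ hs hN hε hρ hΔ hτ' hroom hNΔ =>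
      h s N ε ρ τ Δ hτ hs hN hε hρ hΔ hτ' hroom hNΔ⟩
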